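/- Throughout, "increasing", "decreasing" and "monotonic" are meant in the weak sense, $\mathbb{R}^+=(0,\infty)$, and $B(x,r)=\{y\in\Omega : d(x,y)<r\}$. Let $(\Omega,d)$ be a compact metric space equipped with a probability measure $m$ such that every open subset of $\Omega$ is $m$-measurable. Assume condition (M): there are constants $\delta,r_0,a,b>0$ such that $$a\,r^{\delta}\le m(B(x,r))\le b\,r^{\delta}\qquad\text{for all } x\in\Omega \text{ and } 0<r\le r_0 .$$ Let $J$ be an infinite countable set, $\mathcal R=(R_\alpha)_{\alpha\in J}$ a family of points of $\Omega$, and $\beta:J\to\mathbb{R}^+$, $\alpha\mapsto\beta_\alpha$, a function such that $\{\alpha\in J:\beta_\alpha\le T\}$ is finite for every real $T$. Let $\rho:\mathbb{R}^+\to\mathbb{R}^+$ satisfy $\rho(t)\to0$ as $t\to\infty$ and let $k>1$ be real. Suppose that $(\mathcal R,\beta)$ is a local $m$-ubiquitous system relative to $(\rho,k)$, that is, there is a constant $\kappa>0$ such that for every ball $B=B(x,r)$ with $x\in\Omega$ and $0<r\le r_0$ there is $n_0(B)$ with $$m\Big(B\cap\bigcup_{\alpha\in J:\,\beta_\alpha\le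 k^n}B(R_\alpha,\rho(k^n))\Big)\ \ge\ \kappa\, m(B)\qquad\text{for all } n\ge n_0(B).$$ Suppose also that $\rho$ is $k$-regular: there is a constant $\lambda\in(0,1)$ such that $\rho(k^{n+1})\le\lambda\,\rho(k^n)$ for all sufficiently large $n$. Let $\psi:\mathbb{R}^+\to\mathbb{R}^+$ be decreasing and put $$\Lambda(\psi)=\{x\in\Omega : x\in B(R_\alpha,\psi(\beta_\alpha))\text{ for infinitely many }\alpha\in J\}.$$ Let $f$ be a dimension function, i.e. $f:\mathbb{R}^+\to\mathbb{R}^+$ is increasing and continuous with $f(r)\to0$ as $r\to0$, and suppose that $r\mapsto r^{-\delta}f(r)$ is monotonic (increasing or decreasing) on $\mathbb{R}^+$. For $F\subseteq\Omega$ let $$\mathcal H^f(F)=\sup_{\varepsilon>0}\ \inf\Big\{\sum_i f(r_i)\ :\ F\subseteq\bigcup_i B(x_i,r_i),\ x_i\in\Omega,\ 0<r_i\le\varepsilon\Big\}\in[0,\infty],$$ the infimum being over countable (possibly finite) families of balls. If $$\sum_{n=1}^{\infty}\frac{f(\psi(k^n))}{\rho(k^n)^{\delta}}=\infty ,$$ then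 $$\mathcal H^f(\Lambda(\psi))=\mathcal H^f(\Omega).$$ -/

import Mathlib

open Set Filter Topology MeasureTheory
open scoped ENNReal

noncomputable section

namespace Ubiquity

/-! Functions on the positive half-line `(0, ∞)` are total functions `ℝ → ℝ` that are only
constrained, and only evaluated, on `(0, ∞)`.  All balls are open balls. -/

/-- A dimension function: a continuous (weakly) increasing function `f : (0, ∞) → (0, ∞)` with
`f r → 0` as `r → 0`. -/
structure IsDimensionFunction (f : ℝ → ℝ) : Prop where
  pos : ∀ r, 0 < r → 0 < f r
  mono : MonotoneOn f (Ioi 0)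
  cont : ContinuousOn f (Ioi 0)
  tendsto_zero : Tendsto f (𝓝[>] 0) (𝓝 0)

/-- An approximating function: a (weakly) decreasing function `ψ : (0, ∞) → (0, ∞)`. -/
structure IsApproximatingFunction (ψ : ℝ → ℝ) : Prop where
  pos : ∀ t, 0 < t → 0 < ψ t
  anti : AntitoneOn ψ (Ioi 0)

/-- A ubiquity function: a function `ρ : (0, ∞) → (0, ∞)` with `ρ t → 0` as `t → ∞`. -/
structure IsUbiquityFunction (ρ : ℝ → ℝ) : Prop where
  pos : ∀ t, 0 < t → 0 < ρ t
  tendsto_zero : Tendsto ρ atTop (𝓝 0)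

/-- `h` is `k`-regular: for some constant `0 < lam < 1`, `h (k ^ (n + 1)) ≤ lam * h (k ^ n)` for
all sufficiently large `n`. -/
def IsKRegular (k : ℝ) (h : ℝ → ℝ) : Prop :=
  ∃ lam : ℝ, 0 < lam ∧ lam < 1 ∧ ∀ᶠ n : ℕ in atTop, h (k ^ (n + 1)) ≤ lam * h (k ^ n)

section Metric

variable {Ω : Type*} [MetricSpace Ω]

/-- A `ρ`-cover of `F`: a countable collection of balls, each given by its centre and its radius
in `(0, ρ]`, whose union contains `F`. -/
structure IsBallCover (ρ : ℝ) (F : Set Ω) (C : Set (Ω × ℝ)) : Prop where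
  countable : C.Countable
  radius_pos : ∀ b ∈ C, 0 < b.2
  radius_le : ∀ b ∈ C, b.2 ≤ ρ
  subset : F ⊆ ⋃ b ∈ C, Metric.ball b.1 b.2

/-- The infimum of `∑ f (r_i)` over all `ρ`-covers of `F` by balls of radii `r_i`. -/
def hausdorffPre (f : ℝ → ℝ) (ρ : ℝ) (F : Set Ω) : ℝ≥0∞ :=
  ⨅ (C : Set (Ω × ℝ)) (_ : IsBallCover ρ F C), ∑' b : C, ENNReal.ofReal (f b.1.2)

/-- The Hausdorff `f`-measure of a set, defined through covers by balls. -/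
def hausdorffF (f : ℝ → ℝ) (F : Set Ω) : ℝ≥0∞ :=
  ⨆ (ρ : ℝ) (_ : 0 < ρ), hausdorffPre f ρ F

variable {J : Type*}

/-- The `limsup` set of the points lying in the ball `B (R α, ψ (β α))` for infinitely many
indices `α`. -/
def limsupSet (R : J → Ω) (β : J → ℝ) (ψ : ℝ → ℝ) : Set Ω :=
  {x | {α : J | x ∈ Metric.ball (R α) (ψ (β α))}.Infinite}

/-- The union of the balls `B (R α, ρ (k ^ n))` over the indices `α` with `β α ≤ k ^ n`. -/
def ubiquityUnion (R : J → Ω) (β : J → ℝ) (ρ : ℝ → ℝ) (k : ℝ) (n : ℕ) : Set Ω :=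
  ⋃ (α : J) (_ : β α ≤ k ^ n), Metric.ball (R α) (ρ (k ^ n))

variable [MeasurableSpace Ω]

/-- Condition (M): `a * r ^ δ ≤ m (B (x, r)) ≤ b * r ^ δ` for all balls of radius `r ≤ r₀`, with
positive constants `a`, `b` independent of the ball. -/
def ConditionM (m : Measure Ω) (δ r₀ : ℝ) : Prop :=
  ∃ a b : ℝ, 0 < a ∧ 0 < b ∧ ∀ (x : Ω) (r : ℝ), 0 < r → r ≤ r₀ →
    ENNReal.ofReal (a * r ^ δ) ≤ m (Metric.ball x r) ∧
      m (Metric.ball x r) ≤ ENNReal.ofReal (b * r ^ δ)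

/-- `(R, β)` is a local `m`-ubiquitous system relative to `(ρ, k)`: there is an absolute constant
`κ > 0` such that for each ball `B` of radius at most `r₀`, the `n`-th union fills a proportion at
least `κ` of `B` for all `n ≥ n₀`, where `n₀` may depend on `B`. -/
def IsLocallyUbiquitous (m : Measure Ω) (r₀ : ℝ) (R : J → Ω) (β : J → ℝ) (ρ : ℝ → ℝ) (k : ℝ) :
    Prop :=
  ∃ κ : ℝ, 0 < κ ∧ ∀ (x : Ω) (r : ℝ), 0 < r → r ≤ r₀ → ∃ n₀ : ℕ, ∀ n : ℕ, n₀ ≤ n →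
    ENNReal.ofReal κ * m (Metric.ball x r) ≤ m (Metric.ball x r ∩ ubiquityUnion R β ρ k n)

end Metric

end Ubiquity

end

/-!
The proof is a sequence of greedy selections; it uses neither Cantor measures nor a second-moment
estimate.

*Packing.* Let radii `s n ≤ ρ (k ^ n)` satisfy `∑ (s n / ρ (k ^ n)) ^ δ = ∞`. Then every small ball
`B (y, r)` contains finitely many disjoint balls `B (R α, s n)`, with `β α ≤ k ^ n` and `β α` large,
of total weight `∑ s ^ δ ≥ c r ^ δ`, where `c` depends neither on the ball nor on `s`
(`HasPowerBounds.exists_ubiquity_packing`). Local ubiquity packs `B (y, r)` by about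
`(r / ρ (k ^ n)) ^ δ` disjoint balls of radius `ρ (k ^ n)` centred at resonant points. Level by
level, the concentric balls of radius `s n` that avoid the earlier choices are added. While the
chosen weight is small, at least half of a level survives: the number of its members met by an
earlier ball of radius `s` is at most a constant times `(s / ρ (k ^ n)) ^ δ + 1`, and the number of
earlier balls is a small fraction of the level, because regularity allows the levels to be thinned
to an arithmetic progression along which `ρ` decays as fast as desired. Each level adds at least a
constant times `r ^ δ (s n / ρ (k ^ n)) ^ δ`, so divergence brings the weight up to `c r ^ δ`.

*The case `f r = O (r ^ δ)` near zero.* Then `∑ (ψ (k ^ n) / ρ (k ^ n)) ^ δ = ∞`, and packing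
with `s n = min (ψ (k ^ n)) (ρ (k ^ n))` shows that for each `T` the union of the balls
`B (R α, ψ (β α))` with `β α > T` fills a fixed proportion of every small ball. Its complement `A`
is closed and is covered by balls of radius `6 η` of total weight at most a constant times the
measure of the `η`-neighbourhood of `A` minus `A`, which tends to zero; so `A` is `f`-null
(`hausdorffPre_eq_zero_of_porous`). Countably many such sets cover the complement of the limsup set.

*The case `f r ≠ O (r ^ δ)`.* Then `r ^ (-δ) f r` is decreasing and tends to infinity at zero, and
the limsup set has infinite measure (`HasPowerBounds.hausdorffF_limsupSet_eq_top`). Pick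
`w n ≤ ψ (k ^ n)` with `f (w n) = s n ^ δ = min (f (ψ (k ^ n))) (ρ (k ^ n) ^ δ)` and let a cover `C`
of finite `f`-weight be given. Inside a ball met by little of `C`, measured by `r ^ δ`, packing with
radii `s n` and an averaging argument yield a ball `B (R α, w n)` that the balls of `C` meet with
`f`-weight a small multiple of `f (w n)` (`HasPowerBounds.exists_meetWeight_lt`). By monotonicity
those balls have radius less than `w n`, and the new ball is again met by little of `C`. Iteration
produces nested balls whose common point is in the limsup set and in no member of `C`.
-/

namespace Ubiquity

/-! ### Packing in a space with a regular measure -/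

/-- Two-sided power bounds for the measure of small balls: condition (M) with its constants
named, and stated for the real-valued measure. -/
def HasPowerBounds {Ω : Type*} [MetricSpace Ω] [MeasurableSpace Ω] (m : Measure Ω)
    (δ r₀ a b : ℝ) : Prop :=
  ∀ (x : Ω) (r : ℝ), 0 < r → r ≤ r₀ →
    a * r ^ δ ≤ m.real (Metric.ball x r) ∧ m.real (Metric.ball x r) ≤ b * r ^ δ

theorem ConditionM.exists_hasPowerBounds {Ω : Type*} [MetricSpace Ω] [MeasurableSpace Ω]
    {m : Measure Ω} [IsFiniteMeasure m] {δ r₀ : ℝ} (h : ConditionM m δ r₀) :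
    ∃ a b : ℝ, 0 < a ∧ 0 < b ∧ HasPowerBounds m δ r₀ a b := by
  obtain ⟨a, b, ha, hb, h⟩ := h
  refine ⟨a, b, ha, hb, fun x r hr hr0 => ?_⟩
  obtain ⟨h1, h2⟩ := h x r hr hr0
  constructor
  · exact (ENNReal.ofReal_le_iff_le_toReal (measure_ne_top _ _)).1 h1
  · exact ENNReal.toReal_le_of_le_ofReal (by positivity) h2

section Packing

variable {Ω : Type*} [MetricSpace Ω] [MeasurableSpace Ω] [OpensMeasurableSpace Ω]
  {m : Measure Ω} [IsFiniteMeasure m] {δ r₀ a b : ℝ}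

theorem HasPowerBounds.sum_rpow_le_measureReal (h : HasPowerBounds m δ r₀ a b)
    {ι : Type*} {W : Finset ι} {x : ι → Ω} {s : ι → ℝ} {U : Set Ω}
    (hs : ∀ i ∈ W, 0 < s i) (hs0 : ∀ i ∈ W, s i ≤ r₀)
    (hd : (W : Set ι).PairwiseDisjoint fun i => Metric.ball (x i) (s i))
    (hsub : ∀ i ∈ W, Metric.ball (x i) (s i) ⊆ U) :
    a * ∑ i ∈ W, s i ^ δ ≤ m.real U := by
  calc a * ∑ i ∈ W, s i ^ δ = ∑ i ∈ W, a * s i ^ δ := Finset.mul_sum _ _ _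
    _ ≤ ∑ i ∈ W, m.real (Metric.ball (x i) (s i)) :=
        Finset.sum_le_sum fun i hi => (h _ _ (hs i hi) (hs0 i hi)).1
    _ = m.real (⋃ i ∈ W, Metric.ball (x i) (s i)) :=
        (measureReal_biUnion_finset hd fun i _ => Metric.isOpen_ball.measurableSet).symm
    _ ≤ m.real U := measureReal_mono (iUnion₂_subset hsub)

/-- Disjoint balls inside a ball of radius `t` have total weight `∑ sᵢ ^ δ` at most
`(b / a) t ^ δ`. -/
theorem HasPowerBounds.sum_rpow_le (h : HasPowerBounds m δ r₀ a b)
    {ι : Type*} {W : Finset ι} {x : ι → Ω} {s : ι → ℝ} {y : Ω} {t : ℝ}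
    (hs : ∀ i ∈ W, 0 < s i) (hs0 : ∀ i ∈ W, s i ≤ r₀) (ht : 0 < t) (ht0 : t ≤ r₀)
    (hd : (W : Set ι).PairwiseDisjoint fun i => Metric.ball (x i) (s i))
    (hsub : ∀ i ∈ W, Metric.ball (x i) (s i) ⊆ Metric.ball y t) :
    a * ∑ i ∈ W, s i ^ δ ≤ b * t ^ δ :=
  (h.sum_rpow_le_measureReal hs hs0 hd hsub).trans (h _ _ ht ht0).2

/-- Vitali covering for balls of one common radius. -/
theorem exists_disjoint_balls_covering {Ω ι : Type*} [MetricSpace Ω] (t : Set ι) (x : ι → Ω)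
    {ε : ℝ} (hε : 0 < ε) :
    ∃ u ⊆ t, (u.PairwiseDisjoint fun i => Metric.ball (x i) ε) ∧
      ∀ i ∈ t, ∃ j ∈ u, Metric.ball (x i) ε ⊆ Metric.ball (x j) (6 * ε) := by
  obtain ⟨u, hut, hd, hc⟩ := Vitali.exists_disjoint_subfamily_covering_enlargement_closedBall
    t x (fun _ => ε) ε (fun _ _ => le_rfl) 5 (by norm_num)
  refine ⟨u, hut, hd.mono fun i => Metric.ball_subset_closedBall, fun i hi => ?_⟩
  obtain ⟨j, hj, hij⟩ := hc i hi
  exact ⟨j, hj, Metric.ball_subset_closedBall.trans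
    (hij.trans (Metric.closedBall_subset_ball (by linarith)))⟩

theorem add_two_mul_rpow_le {u v δ : ℝ} (hu : 0 ≤ u) (hv : 0 ≤ v) (hδ : 0 < δ) :
    (u + 2 * v) ^ δ ≤ 3 ^ δ * (u ^ δ + v ^ δ) := by
  have h1 : (u + 2 * v) ^ δ ≤ (3 * max u v) ^ δ := by
    apply Real.rpow_le_rpow (by positivity) _ hδ.le
    have := le_max_left u v
    have := le_max_right u v
    linarith
  have h2 : (max u v) ^ δ ≤ u ^ δ + v ^ δ := by
    have := Real.rpow_nonneg hu δ
    have := Real.rpow_nonneg hv δ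
    rcases max_choice u v with h | h <;> rw [h] <;> linarith
  rw [Real.mul_rpow (by norm_num) (le_max_of_le_left hu)] at h1
  exact h1.trans (mul_le_mul_of_nonneg_left h2 (by positivity))

/-! ### Greedy selection over rapidly shrinking levels -/

variable {J : Type*}

/-- Let `W` be a family of balls of radii at most `r₀ / 3`. The members of a family `G` of disjoint
balls of radius `σ` whose concentric balls of radius `s ≤ σ` meet some ball of `W` are few. -/
theorem HasPowerBounds.card_meeting_le (h : HasPowerBounds m δ r₀ a b) (hδ : 0 < δ) (ha : 0 < a)
    (hb : 0 < b)
    {ι : Type*} {R : J → Ω} {σ s : ℝ} (hσ : 0 < σ) (hσ0 : 3 * σ ≤ r₀) (hsσ : s ≤ σ)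
    {K : Finset J}
    (hd : (K : Set J).PairwiseDisjoint fun α => Metric.ball (R α) σ)
    {W : Finset ι} {x : ι → Ω} {w : ι → ℝ} (hw : ∀ p ∈ W, 0 < w p) (hw0 : ∀ p ∈ W, 3 * w p ≤ r₀)
    (hK : ∀ α ∈ K, ∃ p ∈ W, ¬ Disjoint (Metric.ball (R α) s) (Metric.ball (x p) (w p))) :
    K.card * σ ^ δ ≤ b * 3 ^ δ / a * (∑ p ∈ W, w p ^ δ + W.card * σ ^ δ) := by
  classical
  set Kp : ι → Finset J := fun p =>
    K.filter fun α => ¬ Disjoint (Metric.ball (R α) s) (Metric.ball (x p) (w p)) with hKp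
  have hsub : K ⊆ W.biUnion Kp := by
    intro α hα
    obtain ⟨p, hp, hpα⟩ := hK α hα
    exact Finset.mem_biUnion.2 ⟨p, hp, Finset.mem_filter.2 ⟨hα, hpα⟩⟩
  have hcard : (K.card : ℝ) ≤ ∑ p ∈ W, ((Kp p).card : ℝ) := by
    exact_mod_cast (Finset.card_le_card hsub).trans Finset.card_biUnion_le
  have hone : ∀ p ∈ W, ((Kp p).card : ℝ) * σ ^ δ ≤ b * 3 ^ δ / a * (w p ^ δ + σ ^ δ) := by
    intro p hp
    have h1 := h.sum_rpow_le (W := Kp p) (x := R) (s := fun _ => σ) (y := x p) (t := w p + 2 * σ)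
      (fun _ _ => hσ) (fun _ _ => by linarith) (by have := hw p hp; positivity)
      (by have := hw0 p hp; linarith)
      (hd.subset (by intro α hα; exact (Finset.mem_filter.1 hα).1)) (by
        intro α hα z hz
        obtain ⟨v, hv1, hv2⟩ := not_disjoint_iff.1 (Finset.mem_filter.1 hα).2
        rw [Metric.mem_ball] at *
        have t1 := dist_triangle z (R α) (x p)
        have t2 := dist_triangle_left (R α) (x p) v
        linarith)
    rw [Finset.sum_const, nsmul_eq_mul] at h1
    have h2 := add_two_mul_rpow_le (hw p hp).le hσ.le hδ
    have h3 : b * (w p + 2 * σ) ^ δ ≤ b * (3 ^ δ * (w p ^ δ + σ ^ δ)) := by gcongr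
    rw [div_mul_eq_mul_div, le_div_iff₀ ha]
    linarith
  calc (K.card : ℝ) * σ ^ δ ≤ (∑ p ∈ W, ((Kp p).card : ℝ)) * σ ^ δ := by gcongr
    _ = ∑ p ∈ W, ((Kp p).card : ℝ) * σ ^ δ := Finset.sum_mul _ _ _
    _ ≤ ∑ p ∈ W, b * 3 ^ δ / a * (w p ^ δ + σ ^ δ) := Finset.sum_le_sum hone
    _ = _ := by rw [← Finset.mul_sum, Finset.sum_add_distrib, Finset.sum_const, nsmul_eq_mul]

/-- Let each level `t` carry a packing `G t` of the ball `B (y, r)` by balls of radius `σ t`, with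
`σ` decaying fast. If `∑ (s t / σ t) ^ δ = ∞` with `s t ≤ σ t`, then finitely many of the
concentric balls of radius `s t`, taken from several levels, are disjoint and have total weight
comparable to `r ^ δ`. They are chosen level by level: as long as the weight chosen so far is small,
it obstructs less than half of the next level, because it is small in measure and, thanks to the
decay of `σ`, small in number compared with that level. -/
theorem HasPowerBounds.exists_disjoint_of_not_summable (h : HasPowerBounds m δ r₀ a b)
    (hδ : 0 < δ) (ha : 0 < a) (hb : 0 < b) {R : J → Ω} {y : Ω} {r : ℝ} (hr : 0 < r) (hr0 : r ≤ r₀)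
    {G : ℕ → Finset J} {σ s : ℕ → ℝ} (hσ : ∀ t, 0 < σ t) (hσ0 : ∀ t, 3 * σ t ≤ r₀)
    (hs : ∀ t, 0 < s t) (hsσ : ∀ t, s t ≤ σ t) {q c e : ℝ}
    (hσq : ∀ t, σ (t + 1) ^ δ ≤ q * σ t ^ δ) (he : 0 < e) (hc : 0 < c)
    (hec : 4 * (b * 3 ^ δ / a) * e ≤ c) (heq : (e + b / a) * q ≤ e) (hq : 0 ≤ q)
    (hGsub : ∀ t, ∀ α ∈ G t, Metric.ball (R α) (σ t) ⊆ Metric.ball y r)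
    (hGd : ∀ t, (G t : Set J).PairwiseDisjoint fun α => Metric.ball (R α) (σ t))
    (hGc : ∀ t, c * r ^ δ ≤ (G t).card * σ t ^ δ)
    (hdiv : ¬ Summable fun t => (s t / σ t) ^ δ) :
    ∃ W : Finset (ℕ × J), (∀ p ∈ W, p.2 ∈ G p.1) ∧
      ((W : Set (ℕ × J)).PairwiseDisjoint fun p => Metric.ball (R p.2) (s p.1)) ∧
      e * r ^ δ ≤ ∑ p ∈ W, s p.1 ^ δ := by
  classical
  have hrδ : 0 < r ^ δ := Real.rpow_pos_of_pos hr δ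
  have hX : ∀ t, 0 < σ t ^ δ := fun t => Real.rpow_pos_of_pos (hσ t) δ
  have hY : ∀ t, 0 < s t ^ δ := fun t => Real.rpow_pos_of_pos (hs t) δ
  have hGC : ∀ t, ((G t).card : ℝ) * σ t ^ δ ≤ b / a * r ^ δ := by
    intro t
    have := h.sum_rpow_le (W := G t) (x := R) (s := fun _ => σ t) (y := y) (t := r)
      (fun _ _ => hσ t) (fun _ _ => by linarith [hσ t, hσ0 t]) hr hr0 (hGd t) (hGsub t)
    rw [Finset.sum_const, nsmul_eq_mul] at this
    rw [div_mul_eq_mul_div, le_div_iff₀ ha]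
    linarith
  -- The bound on the cardinality keeps the chosen balls few compared with level `t`; with `q`
  -- small it survives adding the whole of `G t`.
  have key : ∀ t : ℕ, ∃ W : Finset (ℕ × J), (∀ p ∈ W, p.1 < t ∧ p.2 ∈ G p.1) ∧
      ((W : Set (ℕ × J)).PairwiseDisjoint fun p => Metric.ball (R p.2) (s p.1)) ∧
      W.card * σ t ^ δ ≤ e * r ^ δ ∧
      min e (c / 2 * ∑ l ∈ Finset.range t, (s l / σ l) ^ δ) * r ^ δ ≤ ∑ p ∈ W, s p.1 ^ δ := by
    intro t
    induction t with
    | zero =>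
      refine ⟨∅, by simp, by simp, ?_, ?_⟩
      · simpa using by positivity
      · simp [he.le]
    | succ t ih =>
      obtain ⟨W, hWG, hWd, hWc, hWs⟩ := ih
      have hcard : ∀ W' : Finset (ℕ × J), W'.card ≤ W.card + (G t).card →
          (W'.card : ℝ) * σ (t + 1) ^ δ ≤ e * r ^ δ := by
        intro W' hW'
        have h1 : (W'.card : ℝ) ≤ W.card + (G t).card := by exact_mod_cast hW'
        calc (W'.card : ℝ) * σ (t + 1) ^ δ ≤ (W.card + (G t).card) * (q * σ t ^ δ) := by
              gcongr
              · exact (hX _).le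
              · exact hσq t
          _ = q * (W.card * σ t ^ δ + (G t).card * σ t ^ δ) := by ring
          _ ≤ q * (e * r ^ δ + b / a * r ^ δ) := by
              gcongr q * ?_
              exact add_le_add hWc (hGC t)
          _ = ((e + b / a) * q) * r ^ δ := by ring
          _ ≤ e * r ^ δ := by gcongr
      by_cases hbig : e * r ^ δ ≤ ∑ p ∈ W, s p.1 ^ δ
      · refine ⟨W, fun p hp => ⟨(hWG p hp).1.trans t.lt_succ_self, (hWG p hp).2⟩, hWd,
          hcard W (Nat.le_add_right _ _), le_trans ?_ hbig⟩
        gcongr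
        exact min_le_left _ _
      · set K := (G t).filter fun α =>
          ∃ p ∈ W, ¬ Disjoint (Metric.ball (R α) (s t)) (Metric.ball (R p.2) (s p.1)) with hKdef
        have hKG : K ⊆ G t := Finset.filter_subset _ _
        have hKc : (K.card : ℝ) * σ t ^ δ ≤ c / 2 * r ^ δ := by
          have h1 := h.card_meeting_le hδ ha hb (hσ t) (hσ0 t) (hsσ t) (K := K) (R := R)
            ((hGd t).subset (by exact_mod_cast hKG)) (W := W) (x := fun p => R p.2)
            (w := fun p => s p.1) (fun p _ => hs _)
            (fun p _ => by linarith [hsσ p.1, hσ0 p.1])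
            (fun α hα => (Finset.mem_filter.1 hα).2)
          have h2 : b * 3 ^ δ / a * (∑ p ∈ W, s p.1 ^ δ + W.card * σ t ^ δ) ≤
              b * 3 ^ δ / a * (e * r ^ δ + e * r ^ δ) := by
            gcongr
            exact (not_le.1 hbig).le
          have h3 := mul_le_mul_of_nonneg_right hec hrδ.le
          linarith
        set N := (G t \ K).map (Function.Embedding.sectR t J) with hNdef
        have hmemN : ∀ p, p ∈ N ↔ p.1 = t ∧ p.2 ∈ G t ∧ p.2 ∉ K := by
          rintro ⟨l, α⟩
          simp only [hNdef, Finset.mem_map, Finset.mem_sdiff,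
            Function.Embedding.sectR_apply, Prod.mk.injEq]
          constructor
          · rintro ⟨α', ⟨h1, h2⟩, rfl, rfl⟩
            exact ⟨rfl, h1, h2⟩
          · rintro ⟨rfl, h1, h2⟩
            exact ⟨α, ⟨h1, h2⟩, rfl, rfl⟩
        have hWN : Disjoint W N := by
          rw [Finset.disjoint_left]
          intro p hp hpN
          exact (hWG p hp).1.ne ((hmemN p).1 hpN).1
        have hNW : ∀ p ∈ N, ∀ p' ∈ W,
            Disjoint (Metric.ball (R p.2) (s p.1)) (Metric.ball (R p'.2) (s p'.1)) := by
          intro p hp p' hp'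
          obtain ⟨h1, h2, h3⟩ := (hmemN p).1 hp
          by_contra hcon
          rw [h1] at hcon
          exact h3 (Finset.mem_filter.2 ⟨h2, p', hp', hcon⟩)
        refine ⟨W ∪ N, ?_, ?_, ?_, ?_⟩
        · intro p hp
          rcases Finset.mem_union.1 hp with hp | hp
          · exact ⟨(hWG p hp).1.trans t.lt_succ_self, (hWG p hp).2⟩
          · obtain ⟨h1, h2, h3⟩ := (hmemN p).1 hp
            exact ⟨h1 ▸ t.lt_succ_self, h1 ▸ h2⟩
        · intro p hp p' hp' hne
          rcases Finset.mem_union.1 (Finset.mem_coe.1 hp) with hp | hp <;>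
            rcases Finset.mem_union.1 (Finset.mem_coe.1 hp') with hp' | hp'
          · exact hWd hp hp' hne
          · exact (hNW p' hp' p hp).symm
          · exact hNW p hp p' hp'
          · obtain ⟨h1, h2, h3⟩ := (hmemN p).1 hp
            obtain ⟨h1', h2', h3'⟩ := (hmemN p').1 hp'
            have hne' : p.2 ≠ p'.2 := fun hh => hne (Prod.ext (h1.trans h1'.symm) hh)
            have := hGd t h2 h2' hne'
            simp only [Function.onFun, h1, h1'] at this ⊢
            exact this.mono (Metric.ball_subset_ball (hsσ t)) (Metric.ball_subset_ball (hsσ t))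
        · apply hcard
          refine (Finset.card_union_le _ _).trans ?_
          rw [hNdef, Finset.card_map]
          gcongr
          exact Finset.sdiff_subset
        · rw [Finset.sum_union hWN, Finset.sum_range_succ]
          have h1 : ∑ p ∈ N, s p.1 ^ δ = ((G t).card - K.card : ℝ) * s t ^ δ := by
            rw [hNdef, Finset.sum_map]
            simp only [Function.Embedding.sectR_apply, Finset.sum_const, nsmul_eq_mul]
            rw [Finset.card_sdiff_of_subset hKG, Nat.cast_sub (Finset.card_le_card hKG)]
          have h2 : c / 2 * r ^ δ ≤ ((G t).card - K.card : ℝ) * σ t ^ δ := by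
            have := hGc t
            linarith
          have h3 : c / 2 * (s t / σ t) ^ δ * r ^ δ ≤ ∑ p ∈ N, s p.1 ^ δ := by
            rw [h1, Real.div_rpow (hs t).le (hσ t).le]
            calc c / 2 * (s t ^ δ / σ t ^ δ) * r ^ δ = (c / 2 * r ^ δ) * (s t ^ δ / σ t ^ δ) := by
                  ring
              _ ≤ (((G t).card - K.card : ℝ) * σ t ^ δ) * (s t ^ δ / σ t ^ δ) := by
                  have := (div_pos (hY t) (hX t)).le
                  gcongr
              _ = _ := by
                  have := (hX t).ne'
                  field_simp
          have h4 : 0 ≤ c / 2 * (s t / σ t) ^ δ := by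
            have := div_pos (hs t) (hσ t)
            positivity
          have h5 : min e (c / 2 * (∑ l ∈ Finset.range t, (s l / σ l) ^ δ + (s t / σ t) ^ δ)) ≤
              min e (c / 2 * ∑ l ∈ Finset.range t, (s l / σ l) ^ δ) +
                c / 2 * (s t / σ t) ^ δ := by
            rw [← min_add_add_right, mul_add]
            exact min_le_min (by linarith) le_rfl
          have h6 := mul_le_mul_of_nonneg_right h5 hrδ.le
          linarith
  have hnn : ∀ t, 0 ≤ (s t / σ t) ^ δ := fun t => by
    have := div_pos (hs t) (hσ t)
    positivity
  obtain ⟨t, ht⟩ := (((not_summable_iff_tendsto_nat_atTop_of_nonneg hnn).1 hdiv).eventually_ge_atTop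
    (2 * e / c)).exists
  obtain ⟨W, hWG, hWd, -, hWs⟩ := key t
  refine ⟨W, fun p hp => (hWG p hp).2, hWd, ?_⟩
  rwa [min_eq_left] at hWs
  rw [div_le_iff₀ hc] at ht
  linarith

end Packing

/-! ### Packing a ball by small balls around the resonant points -/

theorem IsUbiquityFunction.tendsto_pow {ρ : ℝ → ℝ} (hρ : IsUbiquityFunction ρ) {k : ℝ}
    (hk : 1 < k) : Tendsto (fun n : ℕ => ρ (k ^ n)) atTop (𝓝 0) :=
  hρ.tendsto_zero.comp (tendsto_pow_atTop_atTop_of_one_lt hk)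

theorem tendsto_rpow_zero {u : ℕ → ℝ} (hu : Tendsto u atTop (𝓝 0)) {δ : ℝ} (hδ : 0 < δ) :
    Tendsto (fun n => u n ^ δ) atTop (𝓝 0) := by
  have := hu.rpow_const (p := δ) (Or.inr hδ.le)
  rwa [Real.zero_rpow hδ.ne'] at this

theorem exists_residue_not_summable {u : ℕ → ℝ} (hu : ¬ Summable u) {p : ℕ} (hp : p ≠ 0) :
    ∃ i : ℕ, ¬ Summable fun t => u (p * t + i) := by
  by_contra! hcon
  have : NeZero p := ⟨hp⟩
  apply hu
  have h1 : u = fun n => ∑ i ∈ Finset.range p, {n : ℕ | n % p = i}.indicator u n := by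
    funext n
    rw [Finset.sum_eq_single (n % p)]
    · simp
    · intro i _ hi
      exact indicator_of_notMem (fun h => hi (by simpa using h.symm)) _
    · intro h
      exact absurd (Finset.mem_range.2 (Nat.mod_lt _ (Nat.pos_of_ne_zero hp))) h
  rw [h1]
  refine summable_sum fun i hi => ?_
  have hinj : Function.Injective fun t => p * t + i := fun t t' h => by
    simpa [hp] using h
  refine (hinj.summable_iff ?_).1 ?_
  · intro n hn
    refine indicator_of_notMem (fun h => hn ⟨n / p, ?_⟩) _
    rw [mem_ofPred_eq] at h
    change p * (n / p) + i = n
    rw [← h]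
    exact Nat.div_add_mod n p
  · refine (hcon i).congr fun t => ?_
    have : (p * t + i) % p = i := by
      rw [Nat.mul_add_mod, Nat.mod_eq_of_lt (Finset.mem_range.1 hi)]
    simp [indicator, this]

section Ubiquitous

variable {Ω : Type*} [MetricSpace Ω] [MeasurableSpace Ω] {m : Measure Ω}
  [IsFiniteMeasure m] {δ r₀ a b : ℝ} {J : Type*}

/-- At every sufficiently large level `n`, local ubiquity packs a ball of radius `r` by at least a
constant times `(r / ρ (k ^ n)) ^ δ` balls of radius `ρ (k ^ n)` centred at resonant points, and
finitely many resonant points may be discarded beforehand. -/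
theorem HasPowerBounds.exists_level_packing (h : HasPowerBounds m δ r₀ a b)
    (hδ : 0 < δ) (ha : 0 < a) (hb : 0 < b) {R : J → Ω} {β : J → ℝ}
    (hβfin : ∀ T : ℝ, {α : J | β α ≤ T}.Finite) {ρ : ℝ → ℝ} (hρ : IsUbiquityFunction ρ)
    {k : ℝ} (hk : 1 < k) (hubiq : IsLocallyUbiquitous m r₀ R β ρ k) :
    ∃ c : ℝ, 0 < c ∧ ∀ (y : Ω) (r : ℝ), 0 < r → r ≤ r₀ → ∀ T : ℝ, ∀ᶠ n : ℕ in atTop,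
      ∃ G : Finset J,
        (∀ α ∈ G, T < β α ∧ β α ≤ k ^ n ∧ Metric.ball (R α) (ρ (k ^ n)) ⊆ Metric.ball y r) ∧
        ((G : Set J).PairwiseDisjoint fun α => Metric.ball (R α) (ρ (k ^ n))) ∧
        c * r ^ δ ≤ G.card * ρ (k ^ n) ^ δ := by
  classical
  obtain ⟨κ, hκ, hubiq⟩ := hubiq
  refine ⟨κ * a * (1 / 2) ^ δ / (2 * (b * 6 ^ δ)), by positivity, fun y r hr hr0 T => ?_⟩
  obtain ⟨n₀, hn₀⟩ := hubiq y (r / 2) (by linarith) (by linarith)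
  have hlim := hρ.tendsto_pow hk
  have hlimδ := (tendsto_rpow_zero hlim hδ).const_mul ((hβfin T).toFinset.card * b)
  rw [mul_zero] at hlimδ
  have hC : 0 < κ * (a * (r / 2) ^ δ) / 2 := by positivity
  filter_upwards [eventually_ge_atTop n₀, hlim.eventually_le_const (show 0 < r / 4 by linarith),
    hlim.eventually_le_const (show 0 < r₀ / 6 by linarith), hlimδ.eventually_le_const hC]
    with n hn h4 h6 hF
  have hpos : 0 < ρ (k ^ n) := hρ.pos _ (by positivity)
  set σ := ρ (k ^ n) with hσ
  obtain ⟨u, hut, hud, huc⟩ := exists_disjoint_balls_covering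
    {α : J | T < β α ∧ β α ≤ k ^ n ∧ (Metric.ball (R α) σ ∩ Metric.ball y (r / 2)).Nonempty}
    R hpos
  have hufin : u.Finite := (hβfin (k ^ n)).subset fun α hα => (hut hα).2.1
  refine ⟨hufin.toFinset, ?_, by simpa using hud, ?_⟩
  · intro α hα
    obtain ⟨h1, h2, z, hz1, hz2⟩ := hut (hufin.mem_toFinset.1 hα)
    refine ⟨h1, h2, fun w hw => ?_⟩
    rw [Metric.mem_ball] at *
    have t1 := dist_triangle w (R α) y
    have t2 := dist_triangle_left (R α) y z
    linarith
  · have hcov : Metric.ball y (r / 2) ∩ ubiquityUnion R β ρ k n ⊆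
        (⋃ α ∈ (hβfin T).toFinset, Metric.ball (R α) σ) ∪
          ⋃ α ∈ hufin.toFinset, Metric.ball (R α) (6 * σ) := by
      rintro z ⟨hz, hzU⟩
      obtain ⟨α, hα, hzα⟩ := mem_iUnion₂.1 hzU
      by_cases hT : β α ≤ T
      · exact Or.inl (mem_iUnion₂.2 ⟨α, by simpa using hT, hzα⟩)
      · obtain ⟨α', hα', hsub⟩ := huc α ⟨not_le.1 hT, hα, z, hzα, hz⟩
        exact Or.inr (mem_iUnion₂.2 ⟨α', by simpa using hα', hsub hzα⟩)
    have h1 : κ * m.real (Metric.ball y (r / 2)) ≤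
        m.real (Metric.ball y (r / 2) ∩ ubiquityUnion R β ρ k n) := by
      have := ENNReal.toReal_mono (measure_ne_top _ _) (hn₀ n hn)
      rwa [ENNReal.toReal_mul, ENNReal.toReal_ofReal hκ.le] at this
    have h2 := (h y (r / 2) (by linarith) (by linarith)).1
    have h3 := (measureReal_mono (μ := m) hcov).trans (measureReal_union_le _ _)
    have h4 : m.real (⋃ α ∈ (hβfin T).toFinset, Metric.ball (R α) σ) ≤
        (hβfin T).toFinset.card * b * σ ^ δ := by
      refine (measureReal_biUnion_finset_le _ _).trans
        ((Finset.sum_le_sum fun α _ => (h (R α) σ hpos (by linarith)).2).trans ?_)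
      rw [Finset.sum_const, nsmul_eq_mul, mul_assoc]
    have h5 : m.real (⋃ α ∈ hufin.toFinset, Metric.ball (R α) (6 * σ)) ≤
        hufin.toFinset.card * (b * (6 * σ) ^ δ) := by
      refine (measureReal_biUnion_finset_le _ _).trans
        ((Finset.sum_le_sum fun α _ => (h (R α) (6 * σ) (by linarith) (by linarith)).2).trans ?_)
      rw [Finset.sum_const, nsmul_eq_mul]
    have h7 : κ * (a * (r / 2) ^ δ) ≤ κ * m.real (Metric.ball y (r / 2)) := by gcongr
    rw [Real.mul_rpow (by norm_num) hpos.le] at h5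
    have hhalf : (r / 2) ^ δ = (1 / 2) ^ δ * r ^ δ := by
      rw [← Real.mul_rpow (by norm_num) hr.le]
      congr 1
      ring
    rw [hhalf] at h7 hF
    rw [div_mul_eq_mul_div, div_le_iff₀ (by positivity)]
    linarith

/-- The covering statement that carries both the measure part and the Hausdorff part. Given radii
`s n ≤ ρ (k ^ n)` with `∑ (s n / ρ (k ^ n)) ^ δ = ∞`, every small ball of radius `r` contains
finitely many disjoint balls `B (R α, s n)`, with `β α ≤ k ^ n` and `β α` large, of total weight at
least `c * r ^ δ`; the constant `c` does not depend on `s`. The regularity of `ρ` enters by thinning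
the levels to an arithmetic progression of large step, along which `ρ (k ^ n)` decays as fast as the
greedy selection requires. -/
theorem HasPowerBounds.exists_ubiquity_packing [OpensMeasurableSpace Ω]
    (h : HasPowerBounds m δ r₀ a b)
    (hδ : 0 < δ) (hr₀ : 0 < r₀) (ha : 0 < a) (hb : 0 < b) {R : J → Ω} {β : J → ℝ}
    (hβfin : ∀ T : ℝ, {α : J | β α ≤ T}.Finite) {ρ : ℝ → ℝ} (hρ : IsUbiquityFunction ρ)
    {k : ℝ} (hk : 1 < k) (hubiq : IsLocallyUbiquitous m r₀ R β ρ k) (hreg : IsKRegular k ρ) :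
    ∃ c : ℝ, 0 < c ∧ ∀ s : ℕ → ℝ, (∀ n, 0 < s n) → (∀ n, s n ≤ ρ (k ^ n)) →
      (¬ Summable fun n => (s n / ρ (k ^ n)) ^ δ) →
      ∀ (y : Ω) (r : ℝ), 0 < r → r ≤ r₀ → ∀ η : ℝ, 0 < η → ∀ T : ℝ, ∃ W : Finset (ℕ × J),
        (∀ p ∈ W, T < β p.2 ∧ β p.2 ≤ k ^ p.1 ∧ s p.1 < η ∧
          Metric.ball (R p.2) (s p.1) ⊆ Metric.ball y r) ∧
        ((W : Set (ℕ × J)).PairwiseDisjoint fun p => Metric.ball (R p.2) (s p.1)) ∧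
        c * r ^ δ ≤ ∑ p ∈ W, s p.1 ^ δ := by
  classical
  obtain ⟨c, hc, hlevel⟩ := h.exists_level_packing hδ ha hb hβfin hρ hk hubiq
  obtain ⟨lam, hlam0, hlam1, hreg⟩ := hreg
  have hK : 0 < b * 3 ^ δ / a := by positivity
  set e : ℝ := c / (4 * (b * 3 ^ δ / a)) with he_def
  have he : 0 < e := by positivity
  have hec : 4 * (b * 3 ^ δ / a) * e ≤ c := by rw [he_def]; field_simp; rfl
  have hlamδ : lam ^ δ < 1 := Real.rpow_lt_one hlam0.le hlam1 hδ
  -- `p` is the step of the progression of levels: `ρ ^ δ` then decays by the factor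
  -- `(lam ^ δ) ^ p` from one chosen level to the next.
  obtain ⟨p, hp⟩ := exists_pow_lt_of_lt_one (show 0 < e / (e + b / a) by positivity) hlamδ
  have hp0 : p ≠ 0 := by
    rintro rfl
    rw [pow_zero, lt_div_iff₀ (by positivity)] at hp
    have : 0 < b / a := by positivity
    linarith
  have heq : (e + b / a) * (lam ^ δ) ^ p ≤ e := by
    rw [lt_div_iff₀ (by positivity)] at hp
    linarith
  refine ⟨e, he, fun s hs hsρ hdiv y r hr hr0 η hη T => ?_⟩
  have hlim := hρ.tendsto_pow hk
  obtain ⟨N, hN⟩ := eventually_atTop.1 ((hlevel y r hr hr0 T).and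
    ((hlim.eventually_le_const (show 0 < r₀ / 3 by linarith)).and
      ((hlim.eventually_lt_const hη).and hreg)))
  obtain ⟨i, hi⟩ := exists_residue_not_summable
    (fun hcon => hdiv ((summable_nat_add_iff N).1 hcon)) hp0
  set g : ℕ → ℕ := fun t => p * t + i + N with hg
  have hgN : ∀ t, N ≤ g t := fun t => Nat.le_add_left _ _
  have hginj : Function.Injective g := fun t t' ht => by simpa [hg, hp0] using ht
  choose G hG using fun t => (hN (g t) (hgN t)).1
  have hpos : ∀ n : ℕ, 0 < ρ (k ^ n) := fun n => hρ.pos _ (by positivity)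
  have hdecay : ∀ n, N ≤ n → ∀ j : ℕ, ρ (k ^ (n + j)) ≤ lam ^ j * ρ (k ^ n) := by
    intro n hn j
    induction j with
    | zero => simp
    | succ j ih =>
      calc ρ (k ^ (n + (j + 1))) ≤ lam * ρ (k ^ (n + j)) :=
            (hN (n + j) (hn.trans (Nat.le_add_right _ _))).2.2.2
        _ ≤ lam * (lam ^ j * ρ (k ^ n)) := by gcongr
        _ = _ := by ring
  obtain ⟨W, hWG, hWd, hWs⟩ := h.exists_disjoint_of_not_summable hδ ha hb (R := R) (y := y) hr hr0
    (G := G) (σ := fun t => ρ (k ^ g t)) (s := fun t => s (g t)) (q := (lam ^ δ) ^ p)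
    (fun t => hpos _) (fun t => by linarith [(hN (g t) (hgN t)).2.1]) (fun t => hs _)
    (fun t => hsρ _) (fun t => by
      have h1 := hdecay (g t) (hgN t) p
      have h2 : g (t + 1) = g t + p := by simp only [hg]; ring
      rw [← h2] at h1
      have h3 := Real.rpow_le_rpow (hpos _).le h1 hδ.le
      rwa [Real.mul_rpow (by positivity) (hpos _).le, ← Real.rpow_natCast_mul hlam0.le,
        mul_comm (p : ℝ) δ, Real.rpow_mul_natCast hlam0.le] at h3)
    he hc hec heq (by positivity) (fun t α hα => ((hG t).1 α hα).2.2) (fun t => (hG t).2.1)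
    (fun t => (hG t).2.2) hi
  refine ⟨W.map (Function.Embedding.prodMap ⟨g, hginj⟩ (Function.Embedding.refl J)), ?_, ?_, ?_⟩
  · intro x hx
    obtain ⟨⟨t, α⟩, hq, rfl⟩ := Finset.mem_map.1 hx
    obtain ⟨h1, h2, h3⟩ := (hG t).1 α (hWG _ hq)
    exact ⟨h1, h2, (hsρ _).trans_lt (hN (g t) (hgN t)).2.2.1,
      (Metric.ball_subset_ball (hsρ _)).trans h3⟩
  · intro x hx x' hx' hne
    obtain ⟨q, hq, rfl⟩ := Finset.mem_map.1 (Finset.mem_coe.1 hx)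
    obtain ⟨q', hq', rfl⟩ := Finset.mem_map.1 (Finset.mem_coe.1 hx')
    exact hWd hq hq' fun hqq => hne (by rw [hqq])
  · rw [Finset.sum_map]
    exact hWs

end Ubiquitous

/-! ### Hausdorff measures -/

section Hausdorff

variable {Ω : Type*} [MetricSpace Ω] {f : ℝ → ℝ} {ε : ℝ}

theorem IsBallCover.hausdorffPre_le {F : Set Ω} {C : Set (Ω × ℝ)} (hC : IsBallCover ε F C) :
    hausdorffPre f ε F ≤ ∑' b : C, ENNReal.ofReal (f b.1.2) :=
  iInf₂_le C hC

theorem exists_isBallCover_tsum_lt {F : Set Ω} {M : ℝ≥0∞} (h : hausdorffPre f ε F < M) :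
    ∃ C : Set (Ω × ℝ), IsBallCover ε F C ∧ ∑' b : C, ENNReal.ofReal (f b.1.2) < M := by
  simpa only [hausdorffPre, iInf_lt_iff, exists_prop] using h

theorem hausdorffPre_mono {F F' : Set Ω} (h : F ⊆ F') :
    hausdorffPre f ε F ≤ hausdorffPre f ε F' :=
  le_iInf₂ fun _ hC =>
    IsBallCover.hausdorffPre_le ⟨hC.countable, hC.radius_pos, hC.radius_le, h.trans hC.subset⟩

theorem hausdorffPre_iUnion_le (F : ℕ → Set Ω) :
    hausdorffPre f ε (⋃ n, F n) ≤ ∑' n, hausdorffPre f ε (F n) := by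
  refine ENNReal.le_of_forall_pos_le_add fun η hη hfin => ?_
  obtain ⟨η', hη'0, hη'⟩ := ENNReal.exists_pos_sum_of_countable (ι := ℕ)
    (show (η : ℝ≥0∞) ≠ 0 by exact_mod_cast hη.ne')
  have hlt : ∀ n, hausdorffPre f ε (F n) < hausdorffPre f ε (F n) + η' n := fun n =>
    ENNReal.lt_add_right (ENNReal.ne_top_of_tsum_ne_top hfin.ne n)
      (by exact_mod_cast (hη'0 n).ne')
  choose C hC hCs using fun n => exists_isBallCover_tsum_lt (hlt n)
  have hcov : IsBallCover ε (⋃ n, F n) (⋃ n, C n) := by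
    refine ⟨countable_iUnion fun n => (hC n).countable, ?_, ?_, ?_⟩
    · intro b hb
      obtain ⟨n, hn⟩ := mem_iUnion.1 hb
      exact (hC n).radius_pos b hn
    · intro b hb
      obtain ⟨n, hn⟩ := mem_iUnion.1 hb
      exact (hC n).radius_le b hn
    · refine iUnion_subset fun n => (hC n).subset.trans ?_
      exact biUnion_subset_biUnion_left (subset_iUnion C n)
  calc hausdorffPre f ε (⋃ n, F n) ≤ ∑' b : ⋃ n, C n, ENNReal.ofReal (f b.1.2) :=
        hcov.hausdorffPre_le
    _ ≤ ∑' n, ∑' b : C n, ENNReal.ofReal (f b.1.2) :=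
        ENNReal.tsum_iUnion_le_tsum (fun b : Ω × ℝ => ENNReal.ofReal (f b.2)) C
    _ ≤ ∑' n, (hausdorffPre f ε (F n) + η' n) := ENNReal.tsum_le_tsum fun n => (hCs n).le
    _ = ∑' n, hausdorffPre f ε (F n) + ∑' n, (η' n : ℝ≥0∞) := ENNReal.tsum_add
    _ ≤ _ := by gcongr

theorem hausdorffF_mono {F F' : Set Ω} (h : F ⊆ F') : hausdorffF f F ≤ hausdorffF f F' :=
  iSup₂_mono fun ε _ => hausdorffPre_mono (f := f) (ε := ε) h

/-- A set together with countably many null sets has the Hausdorff measure of that set. -/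
theorem hausdorffF_univ_le_of_null {F : Set Ω} {A : ℕ → Set Ω} (hcov : univ ⊆ F ∪ ⋃ n, A n)
    (hA : ∀ ε, 0 < ε → ∀ n, hausdorffPre f ε (A n) = 0) :
    hausdorffF f (univ : Set Ω) ≤ hausdorffF f F := by
  refine iSup₂_mono fun ε hε => ?_
  set B : ℕ → Set Ω := fun n => n.casesOn F A with hB
  have hsub : (univ : Set Ω) ⊆ ⋃ n, B n := by
    refine hcov.trans (union_subset (subset_iUnion B 0) (iUnion_subset fun n => ?_))
    exact subset_iUnion B (n + 1)
  calc hausdorffPre f ε univ ≤ ∑' n, hausdorffPre f ε (B n) :=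
        (hausdorffPre_mono hsub).trans (hausdorffPre_iUnion_le B)
    _ = hausdorffPre f ε (B 0) := tsum_eq_single 0 fun n hn => by
        obtain ⟨n, rfl⟩ := Nat.exists_eq_succ_of_ne_zero hn
        exact hA ε hε n
    _ = hausdorffPre f ε F := rfl

/-- A closed set whose complement fills a fixed proportion of every small ball is null for every
`f` with `f r = O (r ^ δ)`: cover it by balls of radius `6 η` whose concentric balls of radius `η`
are disjoint; these have weight at most a constant times the measure of the `η`-neighbourhood
of the set with the set itself removed, which tends to zero. -/
theorem hausdorffPre_eq_zero_of_porous [TopologicalSpace.SeparableSpace Ω] [MeasurableSpace Ω]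
    [OpensMeasurableSpace Ω] {m : Measure Ω} [IsFiniteMeasure m] {δ r₀ c C : ℝ} (hr₀ : 0 < r₀)
    (hc : 0 < c) (hC : 0 ≤ C) {A : Set Ω} (hA : IsClosed A)
    (hporous : ∀ (x : Ω) (r : ℝ), 0 < r → r ≤ r₀ → c * r ^ δ ≤ m.real (Metric.ball x r \ A))
    (hf : ∀ r, 0 < r → r ≤ 1 → f r ≤ C * r ^ δ) (hε : 0 < ε) :
    hausdorffPre f ε A = 0 := by
  set D : ℝ≥0∞ := ENNReal.ofReal (C * 6 ^ δ / c) with hD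
  have hlim : Tendsto (fun η => D * m (Metric.thickening η A \ A)) (𝓝[>] 0) (𝓝 0) := by
    have h1 : Tendsto (fun η => m (Metric.thickening η A)) (𝓝[>] 0) (𝓝 (m A)) :=
      tendsto_measure_thickening_of_isClosed ⟨1, one_pos, measure_ne_top _ _⟩ hA
    have h2 := ENNReal.Tendsto.sub h1 (tendsto_const_nhds (x := m A))
      (Or.inl (measure_ne_top _ _))
    rw [tsub_self] at h2
    have h3 := ENNReal.Tendsto.const_mul (a := D) h2 (Or.inr ENNReal.ofReal_ne_top)
    rw [mul_zero] at h3
    refine h3.congr' ?_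
    filter_upwards [self_mem_nhdsWithin] with η hη
    rw [measure_sdiff (Metric.self_subset_thickening hη A) hA.measurableSet.nullMeasurableSet
      (measure_ne_top _ _)]
  refine le_antisymm (ge_of_tendsto hlim ?_) zero_le
  filter_upwards [self_mem_nhdsWithin, nhdsWithin_le_nhds (eventually_le_nhds hr₀),
    nhdsWithin_le_nhds (eventually_le_nhds (show 0 < ε / 6 by linarith)),
    nhdsWithin_le_nhds (eventually_le_nhds (show (0 : ℝ) < 1 / 6 by norm_num))]
    with η hη h0 h1 h2
  rw [mem_Ioi] at hη
  obtain ⟨u, huA, hud, huc⟩ := exists_disjoint_balls_covering A id hη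
  simp only [id] at hud huc
  have hucount : u.Countable := hud.countable_of_isOpen (fun _ _ => Metric.isOpen_ball)
    (fun x _ => ⟨x, Metric.mem_ball_self hη⟩)
  have hcov : IsBallCover ε A ((fun x => (x, 6 * η)) '' u) := by
    refine ⟨hucount.image _, ?_, ?_, ?_⟩
    · rintro _ ⟨x, _, rfl⟩
      change 0 < 6 * η
      linarith
    · rintro _ ⟨x, _, rfl⟩
      change 6 * η ≤ ε
      linarith
    · intro x hx
      obtain ⟨x', hx', hsub⟩ := huc x hx
      exact mem_iUnion₂.2 ⟨_, mem_image_of_mem _ hx', hsub (Metric.mem_ball_self hη)⟩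
  have hone : ∀ x : Ω, ENNReal.ofReal (f (6 * η)) ≤ D * m (Metric.ball x η \ A) := by
    intro x
    have h3 : f (6 * η) ≤ C * 6 ^ δ / c * m.real (Metric.ball x η \ A) := by
      calc f (6 * η) ≤ C * (6 * η) ^ δ := hf _ (by linarith) (by linarith)
        _ = C * 6 ^ δ / c * (c * η ^ δ) := by
            rw [Real.mul_rpow (by norm_num) hη.le]
            field_simp
        _ ≤ _ := by
            gcongr
            exact hporous x η hη h0
    refine (ENNReal.ofReal_le_ofReal h3).trans ?_
    rw [ENNReal.ofReal_mul (by positivity), ofReal_measureReal]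
  calc hausdorffPre f ε A
      ≤ ∑' b : (fun x => (x, 6 * η)) '' u, ENNReal.ofReal (f b.1.2) := hcov.hausdorffPre_le
    _ = ∑' _ : u, ENNReal.ofReal (f (6 * η)) :=
        tsum_image (fun b : Ω × ℝ => ENNReal.ofReal (f b.2))
          (fun x _ x' _ h => (Prod.mk.inj h).1)
    _ ≤ ∑' x : u, D * m (Metric.ball x.1 η \ A) := ENNReal.tsum_le_tsum fun x => hone x
    _ = D * m (⋃ x ∈ u, Metric.ball x η \ A) := by
        rw [ENNReal.tsum_mul_left, measure_biUnion hucount (hud.mono fun x => sdiff_subset)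
          fun x _ => Metric.isOpen_ball.measurableSet.diff hA.measurableSet]
    _ ≤ D * m (Metric.thickening η A \ A) := by
        gcongr
        refine iUnion₂_subset fun x hx => sdiff_subset_sdiff_left ?_
        exact Metric.ball_subset_thickening (huA hx) η

end Hausdorff

/-! ### Limsup sets of full measure -/

section LimsupSet

variable {Ω : Type*} [MetricSpace Ω] {J : Type*} {R : J → Ω} {β : J → ℝ} {ψ : ℝ → ℝ}

theorem mem_limsupSet_of_forall_exists {x : Ω}
    (h : ∀ T : ℝ, ∃ α, T < β α ∧ x ∈ Metric.ball (R α) (ψ (β α))) :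
    x ∈ limsupSet R β ψ := by
  intro hfin
  obtain ⟨T, hT⟩ := (hfin.image β).bddAbove
  obtain ⟨α, hα, hxα⟩ := h T
  exact hα.not_ge (hT (mem_image_of_mem β hxα))

/-- If the balls with `β α` large fill a fixed proportion of every small ball, the limsup set has
the Hausdorff measure of the whole space for every `f` with `f r = O (r ^ δ)`. -/
theorem hausdorffF_limsupSet_eq_of_le [TopologicalSpace.SeparableSpace Ω] [MeasurableSpace Ω]
    [OpensMeasurableSpace Ω] {m : Measure Ω} [IsFiniteMeasure m] {δ r₀ c C : ℝ} (hr₀ : 0 < r₀)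
    (hc : 0 < c) (hC : 0 ≤ C) {f : ℝ → ℝ} (hf : ∀ r, 0 < r → r ≤ 1 → f r ≤ C * r ^ δ)
    (hfill : ∀ (T : ℝ) (y : Ω) (r : ℝ), 0 < r → r ≤ r₀ → c * r ^ δ ≤
      m.real (Metric.ball y r ∩ ⋃ (α : J) (_ : T < β α), Metric.ball (R α) (ψ (β α)))) :
    hausdorffF f (limsupSet R β ψ) = hausdorffF f (univ : Set Ω) := by
  refine le_antisymm (hausdorffF_mono (subset_univ _)) (hausdorffF_univ_le_of_null
    (A := fun n : ℕ => (⋃ (α : J) (_ : (n : ℝ) < β α), Metric.ball (R α) (ψ (β α)))ᶜ) ?_ ?_)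
  · intro x _
    by_cases hx : x ∈ limsupSet R β ψ
    · exact Or.inl hx
    · refine Or.inr ?_
      by_contra hcon
      refine hx (mem_limsupSet_of_forall_exists fun T => ?_)
      obtain ⟨n, hn⟩ := exists_nat_ge T
      rw [mem_iUnion, not_exists] at hcon
      obtain ⟨α, hα, hxα⟩ := mem_iUnion₂.1 (not_notMem.1 (hcon n))
      exact ⟨α, hn.trans_lt hα, hxα⟩
  · intro ε hε n
    refine hausdorffPre_eq_zero_of_porous (m := m) hr₀ hc hC
      (isOpen_biUnion fun α _ => Metric.isOpen_ball).isClosed_compl (fun x r hr hr0 => ?_) hf hε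
    rw [sdiff_compl]
    exact hfill n x r hr hr0

end LimsupSet

/-! ### Limsup sets of infinite Hausdorff measure -/

section Infinite

/-- The total weight `∑ g (r)` of the balls of radius `r` in the family `C` that meet `K`. -/
noncomputable def meetWeight {Ω : Type*} [MetricSpace Ω] (C : Set (Ω × ℝ)) (g : ℝ → ℝ) (K : Set Ω) : ℝ≥0∞ :=
  ∑' b : C, {b : Ω × ℝ | (Metric.ball b.1 b.2 ∩ K).Nonempty}.indicator
    (fun b => ENNReal.ofReal (g b.2)) b.1

/-- In a summable family of balls, the balls of small radius have small total weight. -/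
theorem exists_tsum_small_radius_lt {Ω : Type*} {C : Set (Ω × ℝ)} {g : ℝ → ℝ}
    (hpos : ∀ b ∈ C, 0 < b.2) (hfin : ∑' b : C, ENNReal.ofReal (g b.1.2) ≠ ⊤) {ε : ℝ≥0∞}
    (hε : 0 < ε) :
    ∃ η : ℝ, 0 < η ∧ ∑' b : C, {b : Ω × ℝ | b.2 < η}.indicator
      (fun b => ENNReal.ofReal (g b.2)) b.1 < ε := by
  obtain ⟨F, hF⟩ := ((ENNReal.tendsto_tsum_compl_atTop_zero hfin).eventually_lt_const hε).exists
  have h1 : ∀ᶠ η : ℝ in 𝓝[>] 0, ∀ b ∈ F, η ≤ b.1.2 :=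
    (Filter.eventually_all_finset F).2 fun b _ =>
      nhdsWithin_le_nhds (eventually_le_nhds (hpos b.1 b.2))
  obtain ⟨η, hη, hη0⟩ := (h1.and self_mem_nhdsWithin).exists
  refine ⟨η, hη0, lt_of_le_of_lt ?_ hF⟩
  refine le_trans (ENNReal.tsum_le_tsum fun b => ?_)
    (tsum_subtype {b | b ∉ F} fun b : C => ENNReal.ofReal (g b.1.2)).ge
  by_cases hb : b.1.2 < η
  · have hbF : b ∉ F := fun h => (hη b h).not_gt hb
    rw [indicator_of_mem (show b.1 ∈ {b : Ω × ℝ | b.2 < η} from hb),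
      indicator_of_mem (show b ∈ {b | b ∉ F} from hbF)]
  · rw [indicator_of_notMem (show b.1 ∉ {b : Ω × ℝ | b.2 < η} from hb)]
    exact zero_le

variable {Ω : Type*} [MetricSpace Ω] [MeasurableSpace Ω] [OpensMeasurableSpace Ω]
  {m : Measure Ω} [IsFiniteMeasure m] {δ r₀ a b : ℝ}

/-- Let disjoint balls `B (x i, s i)` fill a fixed proportion of a ball `B (y, r)`, and let
`B (x i, w i)` be concentric smaller balls. If the balls of a family `C` that meet `B (y, r)` are
light with respect to `r ^ δ`, and the small balls of `C` are light with respect to `f`, then for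
some `i` the balls of `C` meeting `B (x i, w i)` have `f`-weight less than `e * s i ^ δ`.

The balls of `C` that meet some `B (x i, w i)` with `s i / 4` at most their radius spoil
only a small part of the family. Any other ball of `C` meets at most one of the remaining
`B (x i, w i)`, as its centre lies in `B (x i, s i)`. -/
theorem HasPowerBounds.exists_meetWeight_lt (h : HasPowerBounds m δ r₀ a b)
    (ha : 0 < a) (hb : 0 < b) {f : ℝ → ℝ} {C : Set (Ω × ℝ)}
    (hCpos : ∀ B ∈ C, 0 < B.2) (hC0 : ∀ B ∈ C, 6 * B.2 ≤ r₀) {c c₂ e η r : ℝ} {y : Ω}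
    (hc₂ : 2 * (b * 6 ^ δ / a * c₂) ≤ c) (hc₂0 : 0 ≤ c₂) (he : 0 < e)
    (hr : 0 < r)
    (hlight : meetWeight C (fun u => u ^ δ) (Metric.closedBall y r) ≤ ENNReal.ofReal (c₂ * r ^ δ))
    (htail : ∑' B : C, {B : Ω × ℝ | B.2 < η}.indicator (fun B => ENNReal.ofReal (f B.2)) B.1 <
      ENNReal.ofReal (e * (c / 2 * r ^ δ)))
    {ι : Type*} {W : Finset ι} {x : ι → Ω} {s w : ι → ℝ} (hw : ∀ i ∈ W, 0 < w i)
    (hws : ∀ i ∈ W, 4 * w i ≤ s i) (hs0 : ∀ i ∈ W, s i ≤ r₀) (hsη : ∀ i ∈ W, s i ≤ 4 * η)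
    (hsub : ∀ i ∈ W, Metric.ball (x i) (s i) ⊆ Metric.ball y r)
    (hd : (W : Set ι).PairwiseDisjoint fun i => Metric.ball (x i) (s i))
    (hsum : c * r ^ δ ≤ ∑ i ∈ W, s i ^ δ) :
    ∃ i ∈ W, meetWeight C f (Metric.closedBall (x i) (w i)) < ENNReal.ofReal (e * s i ^ δ) := by
  classical
  by_contra! hcon
  have hs : ∀ i ∈ W, 0 < s i := fun i hi => by linarith [hw i hi, hws i hi]
  have hsδ : ∀ i ∈ W, 0 ≤ s i ^ δ := fun i hi => Real.rpow_nonneg (hs i hi).le δ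
  have hrδ : 0 < r ^ δ := Real.rpow_pos_of_pos hr δ
  set meets : Ω × ℝ → ι → Prop := fun B i =>
    (Metric.ball B.1 B.2 ∩ Metric.closedBall (x i) (w i)).Nonempty with hmeets
  set K := W.filter fun i => ∃ B ∈ C, meets B i ∧ s i ≤ 4 * B.2 with hKdef
  -- The spoilt part: charge each `i` in `K` to a ball of `C` at least as large.
  have hK : ∑ i ∈ K, s i ^ δ ≤ c / 2 * r ^ δ := by
    have hone : ∀ B : C, ∑ i ∈ K, (if meets B.1 i ∧ s i ≤ 4 * B.1.2 then
        ENNReal.ofReal (s i ^ δ) else 0) ≤ ENNReal.ofReal (b * 6 ^ δ / a) *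
        {B : Ω × ℝ | (Metric.ball B.1 B.2 ∩ Metric.closedBall y r).Nonempty}.indicator
          (fun B => ENNReal.ofReal (B.2 ^ δ)) B.1 := by
      intro B
      rw [← Finset.sum_filter]
      set KB := K.filter fun i => meets B.1 i ∧ s i ≤ 4 * B.1.2 with hKB
      have hKBW : ∀ i ∈ KB, i ∈ W := fun i hi =>
        (Finset.mem_filter.1 (Finset.mem_filter.1 hi).1).1
      rcases KB.eq_empty_or_nonempty with hemp | ⟨i, hi⟩
      · rw [hemp, Finset.sum_empty]
        exact zero_le
      · have hmem : B.1 ∈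
            {B : Ω × ℝ | (Metric.ball B.1 B.2 ∩ Metric.closedBall y r).Nonempty} := by
          obtain ⟨v, hv1, hv2⟩ := (Finset.mem_filter.1 hi).2.1
          refine ⟨v, hv1, Metric.ball_subset_closedBall (hsub i (hKBW i hi) ?_)⟩
          rw [Metric.mem_closedBall] at hv2
          rw [Metric.mem_ball]
          linarith [hw i (hKBW i hi), hws i (hKBW i hi)]
        rw [indicator_of_mem hmem, ← ENNReal.ofReal_sum_of_nonneg fun i hi => hsδ i (hKBW i hi),
          ← ENNReal.ofReal_mul (by positivity)]
        apply ENNReal.ofReal_le_ofReal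
        have hBpos := hCpos B.1 B.2
        have h1 := h.sum_rpow_le (W := KB) (x := x) (s := s) (y := B.1.1) (t := 6 * B.1.2)
          (fun i hi => hs i (hKBW i hi)) (fun i hi => hs0 i (hKBW i hi)) (by linarith)
          (hC0 B.1 B.2) (hd.subset fun i hi => hKBW i hi) (by
            intro i hi z hz
            obtain ⟨⟨v, hv1, hv2⟩, h4⟩ := (Finset.mem_filter.1 hi).2
            rw [Metric.mem_ball] at *
            rw [Metric.mem_closedBall] at hv2
            have t1 := dist_triangle z (x i) B.1.1
            have t2 := dist_triangle_left (x i) B.1.1 v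
            linarith [hws i (hKBW i hi)])
        rw [Real.mul_rpow (by norm_num) hBpos.le] at h1
        rw [div_mul_eq_mul_div, le_div_iff₀ ha]
        linarith
    have h1 : ENNReal.ofReal (∑ i ∈ K, s i ^ δ) ≤
        ENNReal.ofReal (b * 6 ^ δ / a * (c₂ * r ^ δ)) := by
      rw [ENNReal.ofReal_sum_of_nonneg fun i hi => hsδ i (Finset.mem_filter.1 hi).1,
        ENNReal.ofReal_mul (by positivity)]
      calc ∑ i ∈ K, ENNReal.ofReal (s i ^ δ)
          ≤ ∑ i ∈ K, ∑' B : C, (if meets B.1 i ∧ s i ≤ 4 * B.1.2 then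
              ENNReal.ofReal (s i ^ δ) else 0) := by
            refine Finset.sum_le_sum fun i hi => ?_
            obtain ⟨B, hB, hBi⟩ := (Finset.mem_filter.1 hi).2
            refine le_trans ?_ (ENNReal.le_tsum ⟨B, hB⟩)
            rw [if_pos hBi]
        _ = ∑' B : C, ∑ i ∈ K, (if meets B.1 i ∧ s i ≤ 4 * B.1.2 then
              ENNReal.ofReal (s i ^ δ) else 0) :=
            (Summable.tsum_finsetSum fun _ _ => ENNReal.summable).symm
        _ ≤ _ := ENNReal.tsum_le_tsum hone
        _ = ENNReal.ofReal (b * 6 ^ δ / a) *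
            meetWeight C (fun u => u ^ δ) (Metric.closedBall y r) := ENNReal.tsum_mul_left
        _ ≤ _ := by gcongr
    rw [ENNReal.ofReal_le_ofReal_iff (by positivity)] at h1
    have h2 := mul_le_mul_of_nonneg_right hc₂ hrδ.le
    linarith
  have hunspoilt : c / 2 * r ^ δ ≤ ∑ i ∈ W \ K, s i ^ δ := by
    have := Finset.sum_sdiff (f := fun i => s i ^ δ) (Finset.filter_subset _ W : K ⊆ W)
    linarith
  -- Each ball of `C` meets at most one of the unspoilt `B (x i, w i)`, and only if it is small.
  have hone : ∀ B : C, ∑ i ∈ W \ K, (if meets B.1 i then ENNReal.ofReal (f B.1.2) else 0) ≤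
      {B : Ω × ℝ | B.2 < η}.indicator (fun B => ENNReal.ofReal (f B.2)) B.1 := by
    intro B
    have hsmall : ∀ i ∈ W \ K, meets B.1 i → 4 * B.1.2 < s i := by
      intro i hi hBi
      rw [Finset.mem_sdiff] at hi
      by_contra hlt
      exact hi.2 (Finset.mem_filter.2 ⟨hi.1, B.1, B.2, hBi, not_lt.1 hlt⟩)
    by_cases hex : ∃ i ∈ W \ K, meets B.1 i
    · obtain ⟨i, hi, hBi⟩ := hex
      have hcentre : ∀ j ∈ W \ K, meets B.1 j → B.1.1 ∈ Metric.ball (x j) (s j) := by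
        intro j hj hBj
        have h1 := hsmall j hj hBj
        have hjW := (Finset.mem_sdiff.1 hj).1
        obtain ⟨v, hv1, hv2⟩ := hBj
        rw [Metric.mem_ball] at *
        rw [Metric.mem_closedBall] at hv2
        have t1 := dist_triangle_left B.1.1 (x j) v
        linarith [hws j hjW, hw j hjW]
      rw [Finset.sum_eq_single i, if_pos hBi, indicator_of_mem]
      · change B.1.2 < η
        linarith [hsmall i hi hBi, hsη i (Finset.mem_sdiff.1 hi).1]
      · intro j hj hji
        refine if_neg fun hBj => ?_
        exact (hd (Finset.mem_sdiff.1 hj).1 (Finset.mem_sdiff.1 hi).1 hji).le_bot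
          ⟨hcentre j hj hBj, hcentre i hi hBi⟩
      · exact fun hni => absurd hi hni
    · rw [Finset.sum_eq_zero fun i hi => if_neg fun hBi => hex ⟨i, hi, hBi⟩]
      exact zero_le
  have h2 : ENNReal.ofReal (e * (c / 2 * r ^ δ)) ≤
      ∑' B : C, {B : Ω × ℝ | B.2 < η}.indicator (fun B => ENNReal.ofReal (f B.2)) B.1 := by
    calc ENNReal.ofReal (e * (c / 2 * r ^ δ)) ≤ ENNReal.ofReal (∑ i ∈ W \ K, e * s i ^ δ) := by
          rw [← Finset.mul_sum]
          gcongr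
      _ = ∑ i ∈ W \ K, ENNReal.ofReal (e * s i ^ δ) :=
          ENNReal.ofReal_sum_of_nonneg fun i hi =>
            mul_nonneg he.le (hsδ i (Finset.mem_sdiff.1 hi).1)
      _ ≤ ∑ i ∈ W \ K, ∑' B : C, (if meets B.1 i then ENNReal.ofReal (f B.1.2) else 0) := by
          refine Finset.sum_le_sum fun i hi => (hcon i (Finset.mem_sdiff.1 hi).1).trans (le_of_eq ?_)
          rfl
      _ = ∑' B : C, ∑ i ∈ W \ K, (if meets B.1 i then ENNReal.ofReal (f B.1.2) else 0) :=
          (Summable.tsum_finsetSum fun _ _ => ENNReal.summable).symm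
      _ ≤ _ := ENNReal.tsum_le_tsum hone
  exact htail.not_ge h2


/-- If `r ^ (-δ) * f r` is decreasing and the balls of `C` that meet `K` have `f`-weight less than
`e * f w` with `e ≤ 1`, then these balls have radii less than `w` and the weight of their `δ`-th
powers is at most `e * w ^ δ`. -/
theorem meetWeight_rpow_le {Ω : Type*} [MetricSpace Ω] {δ : ℝ} {f : ℝ → ℝ}
    (hf : IsDimensionFunction f) (hanti : AntitoneOn (fun r : ℝ => r ^ (-δ) * f r) (Ioi 0))
    {C : Set (Ω × ℝ)} (hCpos : ∀ B ∈ C, 0 < B.2) {K : Set Ω} {e w : ℝ} (he : 0 < e) (he1 : e ≤ 1)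
    (hw : 0 < w) (h : meetWeight C f K < ENNReal.ofReal (e * f w)) :
    (∀ B ∈ C, (Metric.ball B.1 B.2 ∩ K).Nonempty → B.2 < w) ∧
      meetWeight C (fun u => u ^ δ) K ≤ ENNReal.ofReal (e * w ^ δ) := by
  have hfw := hf.pos w hw
  have hsmall : ∀ B ∈ C, (Metric.ball B.1 B.2 ∩ K).Nonempty → B.2 < w := by
    intro B hB hBK
    by_contra hlt
    have h1 : f w ≤ f B.2 := hf.mono hw (hCpos B hB) (not_lt.1 hlt)
    have h2 : ENNReal.ofReal (f B.2) ≤ meetWeight C f K := by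
      refine le_trans (le_of_eq ?_) (ENNReal.le_tsum (⟨B, hB⟩ : C))
      rw [indicator_of_mem (show B ∈ {b : Ω × ℝ | (Metric.ball b.1 b.2 ∩ K).Nonempty} from hBK)]
    have h3 : e * f w ≤ f B.2 := (mul_le_of_le_one_left hfw.le he1).trans h1
    exact (h2.trans_lt h).not_ge (ENNReal.ofReal_le_ofReal h3)
  refine ⟨hsmall, ?_⟩
  have hone : ∀ B : C, {b : Ω × ℝ | (Metric.ball b.1 b.2 ∩ K).Nonempty}.indicator
      (fun b => ENNReal.ofReal (b.2 ^ δ)) B.1 ≤ ENNReal.ofReal (w ^ δ / f w) *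
      {b : Ω × ℝ | (Metric.ball b.1 b.2 ∩ K).Nonempty}.indicator
        (fun b => ENNReal.ofReal (f b.2)) B.1 := by
    intro B
    by_cases hBK : B.1 ∈ {b : Ω × ℝ | (Metric.ball b.1 b.2 ∩ K).Nonempty}
    · rw [indicator_of_mem hBK, indicator_of_mem hBK, ← ENNReal.ofReal_mul (by positivity)]
      apply ENNReal.ofReal_le_ofReal
      have hBpos := hCpos B.1 B.2
      have h1 : w ^ (-δ) * f w ≤ B.1.2 ^ (-δ) * f B.1.2 :=
        hanti hBpos hw (hsmall B.1 B.2 hBK).le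
      rw [Real.rpow_neg hw.le, Real.rpow_neg hBpos.le, ← div_eq_inv_mul, ← div_eq_inv_mul,
        div_le_div_iff₀ (Real.rpow_pos_of_pos hw δ) (Real.rpow_pos_of_pos hBpos δ)] at h1
      rw [div_mul_eq_mul_div, le_div_iff₀ hfw]
      linarith
    · rw [indicator_of_notMem hBK]
      exact zero_le
  calc meetWeight C (fun u => u ^ δ) K ≤ ENNReal.ofReal (w ^ δ / f w) * meetWeight C f K :=
        (ENNReal.tsum_le_tsum hone).trans_eq ENNReal.tsum_mul_left
    _ ≤ ENNReal.ofReal (w ^ δ / f w) * ENNReal.ofReal (e * f w) := by gcongr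
    _ = ENNReal.ofReal (e * w ^ δ) := by
        rw [← ENNReal.ofReal_mul (by positivity)]
        congr 1
        field_simp

variable {J : Type*} {R : J → Ω} {β : J → ℝ} {ψ : ℝ → ℝ}

/-- If `r ^ (-δ) * f r` decreases and is unbounded near zero, a limsup set whose enlarged balls,
with radii `s n` given by `s n ^ δ = f (w n)`, pack every ball at arbitrarily small scales has
infinite Hausdorff `f`-measure. Given a cover of finite `f`-weight, a nested sequence of balls
`B (R α, w n)` is chosen such that the balls of the cover meeting the current one are ever smaller;
the common point lies in the limsup set and in no ball of the cover. -/
theorem HasPowerBounds.hausdorffF_limsupSet_eq_top [CompactSpace Ω] [Nonempty Ω]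
    (h : HasPowerBounds m δ r₀ a b) (hδ : 0 < δ) (hr₀ : 0 < r₀) (ha : 0 < a) (hb : 0 < b)
    {f : ℝ → ℝ} (hf : IsDimensionFunction f)
    (hanti : AntitoneOn (fun r : ℝ => r ^ (-δ) * f r) (Ioi 0))
    (hunb : ∀ L : ℝ, ∃ r, 0 < r ∧ L * r ^ δ < f r)
    (hψ : IsApproximatingFunction ψ) {k : ℝ} (hk : 1 < k) {s w : ℕ → ℝ} (hs : ∀ n, 0 < s n)
    (hw : ∀ n, 0 < w n) (hwψ : ∀ n, w n ≤ ψ (k ^ n)) (hsw : ∀ n, f (w n) = s n ^ δ)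
    {c : ℝ} (hc : 0 < c)
    (hpack : ∀ (y : Ω) (r : ℝ), 0 < r → r ≤ r₀ → ∀ η : ℝ, 0 < η → ∀ T : ℝ, ∃ W : Finset (ℕ × J),
        (∀ p ∈ W, T < β p.2 ∧ β p.2 ≤ k ^ p.1 ∧ s p.1 < η ∧
          Metric.ball (R p.2) (s p.1) ⊆ Metric.ball y r) ∧
        ((W : Set (ℕ × J)).PairwiseDisjoint fun p => Metric.ball (R p.2) (s p.1)) ∧
        c * r ^ δ ≤ ∑ p ∈ W, s p.1 ^ δ) :
    hausdorffF f (limsupSet R β ψ) = ⊤ := by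
  by_contra hne
  have hlarge : ∀ L : ℝ, ∃ η, 0 < η ∧ ∀ r, 0 < r → r ≤ η → L * r ^ δ ≤ f r := by
    intro L
    obtain ⟨η, hη, hL⟩ := hunb L
    refine ⟨η, hη, fun r hr hrη => ?_⟩
    have h1 : η ^ (-δ) * f η ≤ r ^ (-δ) * f r := hanti hr hη hrη
    have hηδ := Real.rpow_pos_of_pos hη δ
    have hrδ := Real.rpow_pos_of_pos hr δ
    rw [Real.rpow_neg hη.le, Real.rpow_neg hr.le, ← div_eq_inv_mul, ← div_eq_inv_mul] at h1
    exact (le_div_iff₀ hrδ).1 (((lt_div_iff₀ hηδ).2 hL).le.trans h1)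
  set c₂ : ℝ := c / (2 * (b * 6 ^ δ / a)) with hc₂def
  have hc₂ : 0 < c₂ := by positivity
  have hc₂c : 2 * (b * 6 ^ δ / a * c₂) ≤ c := by
    rw [hc₂def]
    field_simp
    rfl
  set e : ℝ := min c₂ 1 with hedef
  have he : 0 < e := lt_min hc₂ one_pos
  set M : ℝ := (hausdorffF f (limsupSet R β ψ)).toReal + 1 with hMdef
  have hM : 0 < M := by positivity
  -- A cover by balls so small that the sum of the powers `r ^ δ` is small as well.
  obtain ⟨η₁, hη₁, hL⟩ := hlarge (M / (c₂ * r₀ ^ δ))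
  obtain ⟨C, hC, hCM⟩ : ∃ C : Set (Ω × ℝ), IsBallCover (min η₁ (r₀ / 6)) (limsupSet R β ψ) C ∧
      ∑' B : C, ENNReal.ofReal (f B.1.2) < ENNReal.ofReal M := by
    apply exists_isBallCover_tsum_lt
    refine lt_of_le_of_lt (le_iSup₂ (f := fun (ε : ℝ) (_ : 0 < ε) =>
      hausdorffPre f ε (limsupSet R β ψ)) (min η₁ (r₀ / 6)) (lt_min hη₁ (by linarith))) ?_
    change hausdorffF f (limsupSet R β ψ) < _
    rw [ENNReal.lt_ofReal_iff_toReal_lt hne]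
    linarith
  have hCpos := hC.radius_pos
  have hfin : ∑' B : C, ENNReal.ofReal (f B.1.2) ≠ ⊤ := (hCM.trans ENNReal.ofReal_lt_top).ne
  have hC0 : ∀ B ∈ C, 6 * B.2 ≤ r₀ := fun B hB => by
    linarith [(hC.radius_le B hB).trans (min_le_right _ _)]
  have hinit : ∀ K : Set Ω, meetWeight C (fun u => u ^ δ) K ≤ ENNReal.ofReal (c₂ * r₀ ^ δ) := by
    intro K
    have hr₀δ := Real.rpow_pos_of_pos hr₀ δ
    calc meetWeight C (fun u => u ^ δ) K
        ≤ ∑' B : C, ENNReal.ofReal (c₂ * r₀ ^ δ / M) * ENNReal.ofReal (f B.1.2) := by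
          refine ENNReal.tsum_le_tsum fun B => (indicator_le_self _ _ _).trans ?_
          rw [← ENNReal.ofReal_mul (by positivity)]
          apply ENNReal.ofReal_le_ofReal
          have h1 := hL B.1.2 (hCpos B.1 B.2) ((hC.radius_le B.1 B.2).trans (min_le_left _ _))
          rw [div_mul_eq_mul_div, div_le_iff₀ (by positivity)] at h1
          rw [div_mul_eq_mul_div, le_div_iff₀ hM]
          linarith
      _ = ENNReal.ofReal (c₂ * r₀ ^ δ / M) * ∑' B : C, ENNReal.ofReal (f B.1.2) :=
          ENNReal.tsum_mul_left
      _ ≤ ENNReal.ofReal (c₂ * r₀ ^ δ / M) * ENNReal.ofReal M := by gcongr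
      _ = ENNReal.ofReal (c₂ * r₀ ^ δ) := by
          rw [← ENNReal.ofReal_mul (by positivity), div_mul_cancel₀ _ hM.ne']
  obtain ⟨η₂, hη₂, hL₂⟩ := hlarge (4 ^ δ)
  -- The invariant of the nested construction: a ball met by little of `C`.
  set Light : Ω × ℝ → Prop := fun p => 0 < p.2 ∧ p.2 ≤ r₀ ∧
    meetWeight C (fun u => u ^ δ) (Metric.closedBall p.1 p.2) ≤ ENNReal.ofReal (c₂ * p.2 ^ δ)
    with hLight
  have hstep : ∀ p : {p // Light p}, ∀ n : ℕ, ∃ p' : {p // Light p}, p'.1.2 < 1 / (n + 1 : ℝ) ∧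
      Metric.closedBall p'.1.1 p'.1.2 ⊆ Metric.ball p.1.1 p.1.2 ∧
      (∃ α, (n : ℝ) < β α ∧ Metric.ball p'.1.1 p'.1.2 ⊆ Metric.ball (R α) (ψ (β α))) ∧
      ∀ B ∈ C, (Metric.ball B.1 B.2 ∩ Metric.closedBall p'.1.1 p'.1.2).Nonempty →
        B.2 < p'.1.2 := by
    rintro ⟨⟨y, r⟩, hr, hr0, hlight⟩ n
    obtain ⟨η, hη, htail⟩ := exists_tsum_small_radius_lt hCpos hfin
      (show 0 < ENNReal.ofReal (e * (c / 2 * r ^ δ)) by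
        have := Real.rpow_pos_of_pos hr δ
        rw [ENNReal.ofReal_pos]
        positivity)
    have hfη₂ := hf.pos η₂ hη₂
    obtain ⟨W, hW, hWd, hWs⟩ := hpack y r hr hr0
      (min (min (4 * η) (1 / (n + 1 : ℝ))) (min r₀ (f η₂ ^ δ⁻¹))) (by positivity) n
    have hWη : ∀ p ∈ W, s p.1 < 4 * η ∧ s p.1 < 1 / (n + 1 : ℝ) ∧ s p.1 < r₀ ∧
        s p.1 < f η₂ ^ δ⁻¹ := by
      intro p hp
      have := (hW p hp).2.2.1
      simp only [lt_min_iff] at this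
      tauto
    have hws : ∀ p ∈ W, 4 * w p.1 ≤ s p.1 := by
      intro p hp
      have h1 : s p.1 ^ δ < f η₂ := by
        have := Real.rpow_lt_rpow (hs p.1).le (hWη p hp).2.2.2 hδ
        rwa [Real.rpow_inv_rpow hfη₂.le hδ.ne'] at this
      have h2 : w p.1 ≤ η₂ := by
        by_contra hlt
        have := hf.mono hη₂ (hw p.1) (not_le.1 hlt).le
        rw [hsw] at this
        linarith
      have h3 := hL₂ (w p.1) (hw p.1) h2
      rw [hsw, ← Real.mul_rpow (by norm_num) (hw p.1).le] at h3
      exact (Real.rpow_le_rpow_iff (by linarith [hw p.1]) (hs p.1).le hδ).1 h3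
    obtain ⟨p, hp, hpw⟩ := h.exists_meetWeight_lt ha hb hCpos hC0 hc₂c hc₂.le he hr hlight htail
      (W := W) (x := fun p => R p.2) (s := fun p => s p.1) (w := fun p => w p.1)
      (fun p _ => hw p.1) hws (fun p hp => (hWη p hp).2.2.1.le) (fun p hp => (hWη p hp).1.le)
      (fun p hp => (hW p hp).2.2.2) hWd hWs
    rw [← hsw] at hpw
    obtain ⟨hsmall, hpow⟩ := meetWeight_rpow_le hf hanti hCpos he (min_le_right _ _) (hw p.1) hpw
    have hws' := hws p hp
    have hwpos := hw p.1
    obtain ⟨h1, h2, h3, h4⟩ := hWη p hp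
    obtain ⟨hT, hTk, -, hsub⟩ := hW p hp
    refine ⟨⟨(R p.2, w p.1), hwpos, ?_, ?_⟩, ?_, ?_, ⟨p.2, hT, ?_⟩, hsmall⟩
    · change w p.1 ≤ r₀
      linarith
    · refine hpow.trans (ENNReal.ofReal_le_ofReal ?_)
      have := Real.rpow_nonneg hwpos.le δ
      exact mul_le_mul_of_nonneg_right (min_le_left _ _) this
    · change w p.1 < _
      linarith
    · exact (Metric.closedBall_subset_ball (by linarith)).trans hsub
    · apply Metric.ball_subset_ball
      have hβ : 0 < β p.2 := (Nat.cast_nonneg n).trans_lt hT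
      exact (hwψ p.1).trans (hψ.anti hβ (pow_pos (by linarith) _ : (0 : ℝ) < k ^ p.1) hTk)
  obtain ⟨y₀⟩ := ‹Nonempty Ω›
  choose next hnext using hstep
  set P : ℕ → {p // Light p} := fun n =>
    Nat.rec ⟨(y₀, r₀), hr₀, le_rfl, hinit _⟩ (fun n p => next p n) n with hP
  have hPsucc : ∀ n, P (n + 1) = next (P n) n := fun n => rfl
  have hsubset : ∀ n, Metric.closedBall (P (n + 1)).1.1 (P (n + 1)).1.2 ⊆
      Metric.ball (P n).1.1 (P n).1.2 := fun n => by
    rw [hPsucc]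
    exact (hnext (P n) n).2.1
  obtain ⟨x, hx⟩ := IsCompact.nonempty_iInter_of_sequence_nonempty_isCompact_isClosed
    (fun n => Metric.closedBall (P n).1.1 (P n).1.2)
    (fun n => (hsubset n).trans Metric.ball_subset_closedBall)
    (fun n => ⟨_, Metric.mem_closedBall_self (P n).2.1.le⟩)
    Metric.isClosed_closedBall.isCompact (fun n => Metric.isClosed_closedBall)
  rw [mem_iInter] at hx
  have hxΛ : x ∈ limsupSet R β ψ := by
    refine mem_limsupSet_of_forall_exists fun T => ?_
    obtain ⟨n, hn⟩ := exists_nat_ge T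
    obtain ⟨α, hα, hsub⟩ := (hnext (P n) n).2.2.1
    exact ⟨α, hn.trans_lt hα, hsub (hsubset (n + 1) (hx (n + 2)))⟩
  obtain ⟨B, hB, hxB⟩ := mem_iUnion₂.1 (hC.subset hxΛ)
  obtain ⟨n, hn⟩ := exists_nat_one_div_lt (hCpos B hB)
  have h1 := (hnext (P n) n).2.2.2 B hB ⟨x, hxB, hx (n + 1)⟩
  have h2 := (hnext (P n) n).1
  linarith

end Infinite

/-! ### The divergence theorem -/

theorem not_summable_min_one {u : ℕ → ℝ} (hu : ¬ Summable u) :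
    ¬ Summable fun n => min (u n) 1 := by
  intro h
  refine hu (h.congr_atTop ?_)
  filter_upwards [h.tendsto_atTop_zero.eventually_lt_const one_pos] with n hn
  exact min_eq_left (not_lt.1 fun h1 => by rw [min_eq_right h1.le] at hn; exact lt_irrefl _ hn)

/-- A dimension function takes every value in `(0, f t]` on `(0, t]`. -/
theorem IsDimensionFunction.exists_eq {f : ℝ → ℝ} (hf : IsDimensionFunction f) {t v : ℝ}
    (ht : 0 < t) (hv : 0 < v) (hvt : v ≤ f t) : ∃ w, 0 < w ∧ w ≤ t ∧ f w = v := by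
  obtain ⟨u, hu, hu0 : 0 < u⟩ := ((hf.tendsto_zero.eventually_lt_const hv).and self_mem_nhdsWithin).exists
  have hut : u ≤ t := by
    by_contra hlt
    linarith [hf.mono ht hu0 (not_le.1 hlt).le]
  obtain ⟨w, hw, rfl⟩ := intermediate_value_Icc hut
    (hf.cont.mono fun z hz => hu0.trans_le hz.1) ⟨hu.le, hvt⟩
  exact ⟨w, hu0.trans_le hw.1, hw.2, rfl⟩

end Ubiquity

theorem mainTheorem1
    {Ω : Type*} [MetricSpace Ω] [CompactSpace Ω] [MeasurableSpace Ω] [OpensMeasurableSpace Ω]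
    (m : Measure Ω) [IsProbabilityMeasure m]
    (δ r₀ : ℝ) (hδ : 0 < δ) (hr₀ : 0 < r₀) (hM : Ubiquity.ConditionM m δ r₀)
    {J : Type*} [Countable J] [Infinite J] (R : J → Ω) (β : J → ℝ)
    (hβpos : ∀ α, 0 < β α) (hβfin : ∀ T : ℝ, {α : J | β α ≤ T}.Finite)
    (ρ : ℝ → ℝ) (hρ : Ubiquity.IsUbiquityFunction ρ) (k : ℝ) (hk : 1 < k)
    (hubiq : Ubiquity.IsLocallyUbiquitous m r₀ R β ρ k)
    (ψ : ℝ → ℝ) (hψ : Ubiquity.IsApproximatingFunction ψ)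
    (f : ℝ → ℝ) (hf : Ubiquity.IsDimensionFunction f)
    (hfmono : MonotoneOn (fun r : ℝ => r ^ (-δ) * f r) (Ioi 0) ∨
      AntitoneOn (fun r : ℝ => r ^ (-δ) * f r) (Ioi 0))
    (hreg : Ubiquity.IsKRegular k ρ)
    (hdiv : ¬ Summable (fun n : ℕ => f (ψ (k ^ (n + 1))) / ρ (k ^ (n + 1)) ^ δ)) :
    Ubiquity.hausdorffF f (Ubiquity.limsupSet R β ψ) =
      Ubiquity.hausdorffF f (univ : Set Ω) := by
  obtain ⟨a, b, ha, hb, h⟩ := hM.exists_hasPowerBounds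
  obtain ⟨c, hc, hpack⟩ := h.exists_ubiquity_packing hδ hr₀ ha hb hβfin hρ hk hubiq hreg
  have hkpos : ∀ n : ℕ, 0 < k ^ n := fun n => by positivity
  have hρpos : ∀ n : ℕ, 0 < ρ (k ^ n) := fun n => hρ.pos _ (hkpos n)
  have hψpos : ∀ n : ℕ, 0 < ψ (k ^ n) := fun n => hψ.pos _ (hkpos n)
  have hdiv' : ¬ Summable fun n : ℕ => f (ψ (k ^ n)) / ρ (k ^ n) ^ δ :=
    fun hcon => hdiv ((summable_nat_add_iff 1).2 hcon)
  by_cases hbd : ∃ C, ∀ r, 0 < r → r ≤ 1 → f r ≤ C * r ^ δ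
  · obtain ⟨C, hC⟩ := hbd
    -- Since `ψ (k ^ n) ≤ ψ 1`, the bound on `f` is only needed on `(0, ψ 1]`; `ψ 1` may exceed `1`.
    have hC0 : 0 ≤ C := by
      have h1 := hC 1 one_pos le_rfl
      rw [Real.one_rpow, mul_one] at h1
      exact (hf.pos 1 one_pos).le.trans h1
    have hψ1 := hψ.pos 1 one_pos
    have hC' : ∀ r, 0 < r → r ≤ ψ 1 → f r ≤ max C (f (ψ 1)) * r ^ δ := by
      intro r hr hrψ
      rcases le_total r 1 with hr1 | hr1
      · exact (hC r hr hr1).trans (by gcongr; exact le_max_left _ _)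
      · calc f r ≤ f (ψ 1) := hf.mono hr hψ1 hrψ
          _ ≤ max C (f (ψ 1)) := le_max_right _ _
          _ ≤ max C (f (ψ 1)) * r ^ δ :=
              le_mul_of_one_le_right (hC0.trans (le_max_left _ _)) (Real.one_le_rpow hr1 hδ.le)
    have hdivψ : ¬ Summable fun n : ℕ => (ψ (k ^ n) / ρ (k ^ n)) ^ δ := by
      intro hcon
      refine hdiv' ((hcon.mul_left (max C (f (ψ 1)))).of_nonneg_of_le (fun n => ?_) fun n => ?_)
      · exact div_nonneg (hf.pos _ (hψpos n)).le (Real.rpow_nonneg (hρpos n).le δ)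
      · rw [Real.div_rpow (hψpos n).le (hρpos n).le, ← mul_div_assoc]
        have := hC' _ (hψpos n) (hψ.anti (mem_Ioi.2 one_pos) (hkpos n) (one_le_pow₀ hk.le))
        have := Real.rpow_pos_of_pos (hρpos n) δ
        gcongr
    have hs : ∀ n : ℕ, 0 < min (ψ (k ^ n)) (ρ (k ^ n)) := fun n => lt_min (hψpos n) (hρpos n)
    have hpackψ := hpack (fun n => min (ψ (k ^ n)) (ρ (k ^ n))) hs (fun n => min_le_right _ _) (by
      convert Ubiquity.not_summable_min_one hdivψ using 3 with n
      rw [← min_div_div_right (hρpos n).le, div_self (hρpos n).ne',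
        (Real.monotoneOn_rpow_Ici_of_exponent_nonneg hδ.le).map_min
          (div_pos (hψpos n) (hρpos n)).le (zero_le_one' ℝ), Real.one_rpow])
    refine Ubiquity.hausdorffF_limsupSet_eq_of_le (m := m) hr₀ (mul_pos ha hc) hC0 hC ?_
    intro T y r hr hr0
    obtain ⟨W, hW, hWd, hWs⟩ := hpackψ y r hr hr0 r₀ hr₀ T
    have h1 := h.sum_rpow_le_measureReal (W := W) (x := fun p => R p.2)
      (s := fun p => min (ψ (k ^ p.1)) (ρ (k ^ p.1)))
      (U := Metric.ball y r ∩ ⋃ (α : J) (_ : T < β α), Metric.ball (R α) (ψ (β α)))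
      (fun p _ => hs p.1) (fun p hp => (hW p hp).2.2.1.le) hWd (by
        intro p hp
        obtain ⟨hT, hTk, -, hsub⟩ := hW p hp
        refine subset_inter hsub fun z hz => mem_iUnion₂.2 ⟨p.2, hT, ?_⟩
        exact Metric.ball_subset_ball ((min_le_left _ _).trans
          (hψ.anti (hβpos p.2) (hkpos p.1) hTk)) hz)
    calc a * c * r ^ δ = a * (c * r ^ δ) := mul_assoc _ _ _
      _ ≤ a * ∑ p ∈ W, min (ψ (k ^ p.1)) (ρ (k ^ p.1)) ^ δ := by gcongr
      _ ≤ _ := h1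
  · push Not at hbd
    -- If `r ^ (-δ) * f r` increased, it would be at most `f 1` on `(0, 1]`.
    have hanti : AntitoneOn (fun r : ℝ => r ^ (-δ) * f r) (Ioi 0) := by
      refine hfmono.resolve_left fun hmon => ?_
      obtain ⟨r, hr, hr1, hfr⟩ := hbd (f 1)
      have h1 : r ^ (-δ) * f r ≤ 1 ^ (-δ) * f 1 := hmon hr (mem_Ioi.2 one_pos) hr1
      rw [Real.one_rpow, one_mul, Real.rpow_neg hr.le, inv_mul_le_iff₀
        (Real.rpow_pos_of_pos hr δ)] at h1
      linarith
    have hρδ : ∀ n : ℕ, 0 < ρ (k ^ n) ^ δ := fun n => Real.rpow_pos_of_pos (hρpos n) δ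
    have hfψ : ∀ n : ℕ, 0 < f (ψ (k ^ n)) := fun n => hf.pos _ (hψpos n)
    have hv : ∀ n : ℕ, 0 < min (f (ψ (k ^ n))) (ρ (k ^ n) ^ δ) := fun n =>
      lt_min (hfψ n) (hρδ n)
    -- The radii are shrunk so that the enlarged radii do not exceed `ρ (k ^ n)`.
    choose w hw hwψ hfw using fun n => hf.exists_eq (hψpos n) (hv n) (min_le_left _ _)
    have hs : ∀ n, 0 < f (w n) ^ δ⁻¹ := fun n => Real.rpow_pos_of_pos (hf.pos _ (hw n)) _
    have hsδ : ∀ n, (f (w n) ^ δ⁻¹) ^ δ = f (w n) := fun n =>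
      Real.rpow_inv_rpow (hf.pos _ (hw n)).le hδ.ne'
    have hpackw := hpack (fun n => f (w n) ^ δ⁻¹) hs (fun n => by
        rw [← Real.rpow_le_rpow_iff (hs n).le (hρpos n).le hδ, hsδ, hfw]
        exact min_le_right _ _) (by
      convert Ubiquity.not_summable_min_one hdiv' using 3 with n
      rw [Real.div_rpow (hs n).le (hρpos n).le, hsδ, hfw, ← min_div_div_right (hρδ n).le,
        div_self (hρδ n).ne'])
    have : Nonempty Ω := m.nonempty_of_neZero
    have htop := h.hausdorffF_limsupSet_eq_top hδ hr₀ ha hb hf hanti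
      (fun L => let ⟨r, hr, _, hL⟩ := hbd L; ⟨r, hr, hL⟩) hψ hk hs hw hwψ
      (fun n => (hsδ n).symm) hc hpackw
    exact le_antisymm (Ubiquity.hausdorffF_mono (subset_univ _)) (htop ▸ le_top)
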